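/- Let $(X,\mathcal B,\mu)$ be a probability space, let $T:X\to X$ be a measurable map preserving $\mu$ (not necessarily invertible), and let $k\ge 1$. Let $\alpha_1,\dots,\alpha_k$ be countable measurable partitions of $X$ with $H_\mu(\alpha_i)=-\sum_{A\in\alpha_i}\mu(A)\log\mu(A)<\infty$ for each $i$, and let $(a_1,\dots,a_k)\in\mathbb R^k$ with $a_1>0$ and $a_i\ge 0$ for $i\ge 2$. For a countable measurable partition $\beta$, write $\beta(x)$ for the cell containing $x$, $\beta_0^{n-1}=\bigvee_{m=0}^{n-1}T^{-m}\beta$, and $I_\mu(\beta)(x)=-\log\mu(\beta(x))$. For a sub-$\sigma$-algebra $\mathcal A\subset\mathcal B$, write $I_\mu(\beta|\mathcal A)(x)=-\sum_{B\in\beta}1_B(x)\log\mathbb E_\mu(1_B|\mathcal A)(x)$. Let $h_\mu(T,\beta)=\lim_{n\to\infty}\frac1n H_\mu(\beta_0^{n-1})$ when $H_\mu(\beta)<\infty$. Put $\mathcal I_\mu=\{B\in\mathcal B:\mu(B\triangle T^{-1}B)=0\}$ and, for $i=1,\dots,k$, $$\beta_i=\bigvee_{j=i}^k\alpha_j,\qquad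 F_i=I_\mu\Big(\beta_i\,\Big|\,\bigvee_{n=1}^\infty T^{-n}\beta_i\Big),$$ where $\bigvee_{n=1}^\infty T^{-n}\beta_i$ is the $\sigma$-algebra generated by the partitions $T^{-n}\beta_i$, $n\ge1$. Then each $F_i$ is $\mu$-integrable, and for $\mu$-almost every $x\in X$ $$\lim_{N\to\infty}\frac1N I_\mu\Big(\bigvee_{i=1}^k(\alpha_i)_0^{\lceil(a_1+\cdots+a_i)N\rceil-1}\Big)(x)=\sum_{i=1}^k a_i\,\mathbb E_\mu(F_i|\mathcal I_\mu)(x).$$ In particular, if $T$ is ergodic, then the limits defining $h_\mu(T,\beta_i)$ exist and for $\mu$-almost every $x\in X$ $$\lim_{N\to\infty}\frac1N I_\mu\Big(\bigvee_{i=1}^k(\alpha_i)_0^{\lceil(a_1+\cdots+a_i)N\rceil-1}\Big)(x)=\sum_{i=1}^k a_i\,h_\mu\Big(T,\bigvee_{j=i}^k\alpha_j\Big).$$ -/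

import Mathlib

open MeasureTheory Filter Topology

/-- A countable measurable partition of `X`, given by the equivalence relation of lying in the
same cell: there are at most countably many cells, and each of them is measurable. -/
structure CountablePartition (X : Type*) [MeasurableSpace X] where
  rel : Setoid X
  countable_quotient : Countable (Quotient rel)
  measurableSet_cell' : ∀ x, MeasurableSet {y | rel y x}

namespace CountablePartition

variable {X : Type*} [MeasurableSpace X]

/-- The cell `P(x)` of the partition that contains `x`. -/
def cell (P : CountablePartition X) (x : X) : Set X := {y | P.rel y x}

/-- The set of all (nonempty) cells of the partition. -/
def parts (P : CountablePartition X) : Set (Set X) := P.rel.classes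

/-- The σ-algebra generated by the cells of the partition. -/
@[reducible]
def sigmaAlgebra (P : CountablePartition X) : MeasurableSpace X :=
  MeasurableSpace.generateFrom P.parts

/-- The pulled back partition `T⁻¹P = {T⁻¹A : A ∈ P}`: the cell of `x` is `T⁻¹(P(Tx))`. -/
def preimage (P : CountablePartition X) (T : X → X) (hT : Measurable T) :
    CountablePartition X where
  rel := Setoid.comap T P.rel
  countable_quotient := by
    have := P.countable_quotient
    refine Function.Injective.countable (β := Quotient P.rel)
      (f := Quotient.map' (s₁ := Setoid.comap T P.rel) T (fun _ _ h => h)) ?_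
    intro a b
    induction a using Quotient.inductionOn'
    induction b using Quotient.inductionOn'
    intro h
    exact Quotient.sound' (Quotient.exact (s := P.rel) h)
  measurableSet_cell' x := hT (P.measurableSet_cell' (T x))

/-- The join (common refinement) of finitely many partitions: two points are in the same cell
iff they are in the same cell of each of the partitions. -/
def join {ι : Type*} [Finite ι] (P : ι → CountablePartition X) : CountablePartition X where
  rel :=
    { r := fun x y => ∀ i, (P i).rel x y
      iseqv :=
        { refl := fun x i => (P i).rel.refl' x
          symm := fun h i => (P i).rel.symm' (h i)
          trans := fun h h' i => (P i).rel.trans' (h i) (h' i) } }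
  countable_quotient := by
    have := fun i => (P i).countable_quotient
    refine Function.Injective.countable (β := ∀ i, Quotient (P i).rel)
      (f := fun q i => Quotient.map' (s₂ := (P i).rel) id
        (fun _ _ (h : ∀ i, (P i).rel _ _) => h i) q) ?_
    intro a b
    induction a using Quotient.inductionOn'
    induction b using Quotient.inductionOn'
    intro h
    exact Quotient.sound' fun i => Quotient.exact (s := (P i).rel) (congrFun h i)
  measurableSet_cell' x := by
    have := MeasurableSet.iInter fun i => (P i).measurableSet_cell' x
    rwa [← Set.ofPred_forall] at this

/-- The partition `P_0^{n-1} = ⋁_{m=0}^{n-1} T^{-m}P` (trivial for `n = 0`). -/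
def iterJoin (P : CountablePartition X) (T : X → X) (hT : Measurable T) (n : ℕ) :
    CountablePartition X :=
  join fun m : Fin n => P.preimage T^[m] (hT.iterate m)

/-- The σ-algebra `⋁_{n=1}^∞ T^{-n}P` of the past. -/
@[reducible]
def past (P : CountablePartition X) (T : X → X) (hT : Measurable T) : MeasurableSpace X :=
  ⨆ n : ℕ, (P.preimage T^[n + 1] (hT.iterate (n + 1))).sigmaAlgebra

/-- The entropy `H_μ(P) = -∑_{A ∈ P} μ(A) log μ(A) ∈ [0, ∞]`. -/
noncomputable def entropy (P : CountablePartition X) (μ : Measure X) : ENNReal :=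
  ∑' A : P.parts, ENNReal.ofReal (Real.negMulLog (μ.real (A : Set X)))

/-- The information function `I_μ(P)(x) = -log μ(P(x))`. -/
noncomputable def info (P : CountablePartition X) (μ : Measure X) (x : X) : ℝ :=
  -Real.log (μ.real (P.cell x))

/-- The conditional information function
`I_μ(P|𝒜)(x) = -∑_{A ∈ P} 1_A(x) log μ(A|𝒜)(x) = -log μ(P(x)|𝒜)(x)`,
where `μ(A|𝒜)` is the conditional expectation of the indicator of `A`. -/
noncomputable def condInfo {X : Type*} (𝒜 : MeasurableSpace X) [MeasurableSpace X]
    (P : CountablePartition X) (μ : Measure X) (x : X) : ℝ :=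
  -Real.log ((μ[(P.cell x).indicator (fun _ => (1 : ℝ)) | 𝒜]) x)

/-- The entropy `h_μ(T, P) = lim_n (1/n) H_μ(P_0^{n-1})` of `T` with respect to `P`. -/
noncomputable def dynEntropy (P : CountablePartition X) (μ : Measure X) (T : X → X)
    (hT : Measurable T) : ℝ :=
  limUnder atTop fun n : ℕ => ((P.iterJoin T hT n).entropy μ).toReal / n

end CountablePartition

/-- The σ-algebra `{B measurable : μ(B ∆ T⁻¹B) = 0}` of `μ`-almost invariant sets. -/
@[reducible]
def almostInvariants {X : Type*} [MeasurableSpace X] (μ : Measure X) (T : X → X) :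
    MeasurableSpace X where
  MeasurableSet' B := MeasurableSet B ∧ μ (symmDiff B (T ⁻¹' B)) = 0
  measurableSet_empty := by simp
  measurableSet_compl B hB := by
    refine ⟨hB.1.compl, ?_⟩
    rw [Set.preimage_compl, compl_symmDiff_compl]
    exact hB.2
  measurableSet_iUnion f hf := by
    refine ⟨MeasurableSet.iUnion fun n => (hf n).1, ?_⟩
    rw [measure_symmDiff_eq_zero_iff, Set.preimage_iUnion]
    exact Filter.EventuallyEq.countable_iUnion fun n => measure_symmDiff_eq_zero_iff.1 (hf n).2

/-! Regroup the join by time. At time `m` only the `α j` with `m < breakTime a N (j + 1)` are still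
active, so the join is `⋁ T⁻ᵐγ_m`, where `γ_m` equals `β i` throughout the `i`-th block and only
coarsens as `m` grows (`seqJoin_activeJoin`). Heuristically its information is a sum of conditional
informations along the orbit, which Birkhoff's theorem evaluates block by block.

The rigorous comparison is made between whole products, not term by term. Two likelihood ratios have
integral at most 1. The first is `μ(cell)` divided by the product of the conditional probabilities
of `γ_m` given its full past (`lintegral_measure_cell_div_prod_condProb_le`). The second is the
product of conditional probabilities given finitely many steps of the past, divided by `μ(cell)`
(`lintegral_prod_condProb_div_measure_cell_le`). By a Borel–Cantelli argument both ratios are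
eventually at most `(N + 1)²` almost everywhere, so the information is bounded below and above by
Birkhoff-type sums up to `2 log (N + 1)`, which is `o(N)`.

The lower sums have the desired limit `L`; the upper sums of order `d` have a limit `U d`. The
sandwich gives `L ≤ U d`, and continuity of conditional entropy along the filtration of finite pasts
(`tendsto_condEntropy`) gives `∫ U d → ∫ L`, hence `inf_d U d = L` almost everywhere. No integrable
bound on a supremum of information functions is needed.

In the ergodic case the conditional expectations are constants `∫ F i`, and telescoping the chain
rule identifies these with the dynamical entropies. -/

/-! ### Birkhoff's pointwise ergodic theorem, via running maxima. -/

section Birkhoff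

variable {X : Type*} {T : X → X}

/-- The running maximum `max (S₁ f, …, Sₙ₊₁ f)` of the Birkhoff sums. -/
noncomputable def birkhoffMax (T : X → X) (f : X → ℝ) : ℕ → X → ℝ
  | 0 => f
  | n + 1 => fun x => f x + max 0 (birkhoffMax T f n (T x))

theorem birkhoffMax_mono (f : X → ℝ) (x : X) : Monotone fun n => birkhoffMax T f n x := by
  have : ∀ n x, birkhoffMax T f n x ≤ birkhoffMax T f (n + 1) x := by
    intro n
    induction n with
    | zero => intro x; simp [birkhoffMax]
    | succ n ih =>
      intro x
      have := ih (T x)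
      simp only [birkhoffMax] at this ⊢
      gcongr
  exact monotone_nat_of_le_succ fun n => this n x

theorem birkhoffSum_le_birkhoffMax (f : X → ℝ) (n : ℕ) (x : X) :
    birkhoffSum T f (n + 1) x ≤ birkhoffMax T f n x := by
  induction n generalizing x with
  | zero => simp [birkhoffMax]
  | succ n ih =>
    rw [birkhoffSum_succ']
    exact add_le_add_right ((ih (T x)).trans (le_max_right _ _)) _

/-- The set where the running maximum is unbounded. -/
def birkhoffUnbounded (T : X → X) (f : X → ℝ) : Set X :=
  {x | Tendsto (fun n => birkhoffMax T f n x) atTop atTop}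

/-- The recursion expresses the maximum at `x` through `f x` and the positive part of the maximum at
`T x`, so the two diverge together. Invariance is exact, not merely up to null sets. -/
theorem preimage_birkhoffUnbounded (f : X → ℝ) :
    T ⁻¹' birkhoffUnbounded T f = birkhoffUnbounded T f := by
  ext x
  simp only [birkhoffUnbounded, Set.mem_preimage, Set.mem_ofPred_eq]
  rw [← tendsto_add_atTop_iff_nat (f := fun n => birkhoffMax T f n x) 1]
  simp only [birkhoffMax, tendsto_atTop]
  constructor
  · intro h b
    filter_upwards [h (b - f x)] with n hn
    linarith [le_max_right 0 (birkhoffMax T f n (T x))]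
  · intro h b
    filter_upwards [h (f x + max b 0 + 1)] with n hn
    have h1 : max b 0 < max 0 (birkhoffMax T f n (T x)) := by linarith
    rcases max_choice 0 (birkhoffMax T f n (T x)) with h2 | h2 <;> rw [h2] at h1
    · exact absurd h1 (not_lt.2 (le_max_right _ _))
    · exact (le_max_left _ _).trans h1.le

theorem bddAbove_birkhoffSum {f : X → ℝ} {x : X} (hx : x ∉ birkhoffUnbounded T f) :
    ∃ C, ∀ n, birkhoffSum T f n x ≤ C := by
  have := tendsto_atTop_of_monotone (birkhoffMax_mono (T := T) f x)
  rcases this with h | ⟨l, hl⟩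
  · exact absurd h hx
  · refine ⟨max 0 l, fun n => ?_⟩
    cases n with
    | zero => simp
    | succ n =>
      exact (birkhoffSum_le_birkhoffMax f n x).trans
        (((birkhoffMax_mono f x).ge_of_tendsto hl n).trans (le_max_right _ _))

variable [MeasurableSpace X] {μ : Measure X}

theorem almostInvariants_le (μ : Measure X) (T : X → X) : almostInvariants μ T ≤ ‹_› :=
  fun _ hB => hB.1

/-- Functions measurable with respect to the almost invariant sets are almost invariant. -/
theorem Measurable.comp_ae_eq_of_almostInvariants {h : X → ℝ}
    (hh : Measurable[almostInvariants μ T] h) : h ∘ T =ᵐ[μ] h := by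
  have key : ∀ᵐ x ∂μ, ∀ q : ℚ, (h (T x) < q ↔ h x < q) := by
    rw [ae_all_iff]
    intro q
    have := (hh (measurableSet_Iio (a := (q : ℝ)))).2
    rw [measure_symmDiff_eq_zero_iff] at this
    filter_upwards [this.mem_iff] with x hx
    exact hx.symm
  filter_upwards [key] with x hx
  refine le_antisymm ?_ ?_
  · refine le_of_forall_rat_lt_imp_le fun q hq => ?_
    by_contra hlt
    exact absurd ((hx q).2 (not_le.1 hlt)) (not_lt.2 hq.le)
  · refine le_of_forall_rat_lt_imp_le fun q hq => ?_
    by_contra hlt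
    exact absurd ((hx q).1 (not_le.1 hlt)) (not_lt.2 hq.le)

theorem integrable_birkhoffMax (hT : MeasurePreserving T μ μ) {f : X → ℝ} (hf : Integrable f μ)
    (n : ℕ) : Integrable (birkhoffMax T f n) μ := by
  induction n with
  | zero => exact hf
  | succ n ih =>
    exact hf.add ((integrable_zero _ _ _).sup (hT.integrable_comp_of_integrable ih))

theorem measurable_birkhoffMax (hT : Measurable T) {f : X → ℝ} (hf : Measurable f) (n : ℕ) :
    Measurable (birkhoffMax T f n) := by
  induction n with
  | zero => exact hf
  | succ n ih => exact hf.add (measurable_const.max (ih.comp hT))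

theorem measurableSet_birkhoffUnbounded (hT : Measurable T) {f : X → ℝ} (hf : Measurable f) :
    MeasurableSet (birkhoffUnbounded T f) :=
  measurableSet_tendsto atTop fun n => measurable_birkhoffMax hT hf n

/-- Write `M n` for the running maximum. On the unbounded set `f = M (n + 1) - M n ∘ T` as soon as
`M n (T x) ≥ 0`. By invariance of the set and the measure, the integral of the right side is that of
`M (n + 1) - M n ≥ 0`. -/
theorem setIntegral_birkhoffUnbounded_nonneg (hT : MeasurePreserving T μ μ) {f : X → ℝ}
    (hfm : Measurable f) (hf : Integrable f μ) :
    0 ≤ ∫ x in birkhoffUnbounded T f, f x ∂μ := by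
  set A := birkhoffUnbounded T f
  have hA : MeasurableSet A := measurableSet_birkhoffUnbounded hT.measurable hfm
  have hTA : MeasurePreserving T (μ.restrict A) (μ.restrict A) := by
    have := hT.restrict_preimage hA
    rwa [preimage_birkhoffUnbounded] at this
  have hlim : Tendsto (fun n => ∫ x in A, (birkhoffMax T f (n + 1) x - birkhoffMax T f n (T x)) ∂μ)
      atTop (𝓝 (∫ x in A, f x ∂μ)) := by
    -- The difference is `f x` plus the negative part of `M n (T x)`, and `M n ≥ f` bounds that part
    -- by `|f (T x)|`.
    refine tendsto_integral_of_dominated_convergence (fun x => |f x| + |f (T x)|) ?_ ?_ ?_ ?_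
    · intro n
      exact ((measurable_birkhoffMax hT.measurable hfm _).sub
        ((measurable_birkhoffMax hT.measurable hfm _).comp hT.measurable)).aestronglyMeasurable
    · exact (hf.abs.add (hT.integrable_comp_of_integrable hf.abs)).integrableOn
    · intro n
      refine Eventually.of_forall fun x => ?_
      have h1 : f (T x) ≤ birkhoffMax T f n (T x) := birkhoffMax_mono f (T x) (Nat.zero_le n)
      simp only [birkhoffMax, Real.norm_eq_abs]
      rcases le_total 0 (birkhoffMax T f n (T x)) with h | h
      · rw [max_eq_right h, add_sub_cancel_right]
        linarith [abs_nonneg (f (T x))]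
      · rw [max_eq_left h, abs_le]
        constructor <;>
          linarith [neg_abs_le (f x), le_abs_self (f x), neg_abs_le (f (T x)), abs_nonneg (f (T x))]
    · refine (ae_restrict_iff' hA).2 (Eventually.of_forall fun x hx => ?_)
      have hx' : T x ∈ A := by
        have : x ∈ T ⁻¹' A := by rw [preimage_birkhoffUnbounded]; exact hx
        exact this
      refine tendsto_const_nhds.congr' ?_
      filter_upwards [hx'.eventually_ge_atTop 0] with n hn
      simp [birkhoffMax, max_eq_right hn]
  refine ge_of_tendsto' hlim fun n => ?_
  have hi := integrable_birkhoffMax hT hf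
  have hiT : Integrable (fun x => birkhoffMax T f n (T x)) (μ.restrict A) :=
    hTA.integrable_comp_of_integrable (hi n).integrableOn
  rw [integral_sub (hi _).integrableOn hiT, sub_nonneg]
  have : ∫ x in A, birkhoffMax T f n (T x) ∂μ = ∫ x in A, birkhoffMax T f n x ∂μ := by
    conv_rhs => rw [← hTA.map_eq]
    rw [integral_map hTA.measurable.aemeasurable
      (measurable_birkhoffMax hT.measurable hfm n).aestronglyMeasurable]
  rw [this]
  exact integral_mono (hi _).integrableOn (hi _).integrableOn
    fun x => birkhoffMax_mono f x (Nat.le_succ n)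

/-- For `g = f - (E[f|ℐ] + ε)` the unbounded set `A` lies in `ℐ`, so `∫_A g = -ε μ(A)`;
nonnegativity of this integral forces `μ(A) = 0`. Off `A` the sums of `g` are bounded above, and
`E[f|ℐ]` is constant along almost every orbit. -/
theorem birkhoffSum_le_of_condExp [IsProbabilityMeasure μ] (hT : MeasurePreserving T μ μ)
    {f : X → ℝ} (hfm : Measurable f) (hf : Integrable f μ) {ε : ℝ} (hε : 0 < ε) :
    ∀ᵐ x ∂μ, ∃ C, ∀ n : ℕ,
      birkhoffSum T f n x ≤ n * ((μ[f | almostInvariants μ T]) x + ε) + C := by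
  set h := μ[f | almostInvariants μ T] with hh
  have hm := almostInvariants_le μ T
  have hhm : Measurable[almostInvariants μ T] h := stronglyMeasurable_condExp.measurable
  have hinv := hhm.comp_ae_eq_of_almostInvariants
  set g : X → ℝ := fun x => f x - (h x + ε)
  have hgm : Measurable g := hfm.sub ((hhm.mono hm le_rfl).add_const ε)
  have hhi : Integrable h μ := integrable_condExp
  have hhe : Integrable (fun x => h x + ε) μ := hhi.add (integrable_const _)
  have hg : Integrable g μ := hf.sub hhe
  have hA : μ (birkhoffUnbounded T g) = 0 := by
    have h0 := setIntegral_birkhoffUnbounded_nonneg hT hgm hg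
    have hAm := measurableSet_birkhoffUnbounded hT.measurable hgm
    have hAI : MeasurableSet[almostInvariants μ T] (birkhoffUnbounded T g) :=
      ⟨hAm, by rw [preimage_birkhoffUnbounded]; simp⟩
    rw [integral_sub hf.integrableOn hhe.integrableOn, integral_add hhi.integrableOn
      (integrable_const _).integrableOn, hh, setIntegral_condExp hm hf hAI] at h0
    simp only [setIntegral_const, smul_eq_mul] at h0
    have h1 : μ.real (birkhoffUnbounded T g) = 0 := by
      have := measureReal_nonneg (μ := μ) (s := birkhoffUnbounded T g)
      nlinarith
    exact (measureReal_eq_zero_iff).1 h1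
  have hinv' : ∀ᵐ x ∂μ, ∀ n : ℕ, h (T^[n] x) = h x := by
    rw [ae_all_iff]
    intro n
    induction n with
    | zero => simp
    | succ n ih =>
      filter_upwards [ih, (hT.iterate n).quasiMeasurePreserving.ae hinv] with x h1 h2
      rw [Function.iterate_succ_apply', ← h1]
      exact h2
  filter_upwards [hinv', measure_eq_zero_iff_ae_notMem.1 hA] with x hx hxA
  obtain ⟨C, hC⟩ := bddAbove_birkhoffSum hxA
  refine ⟨C, fun n => ?_⟩
  have := hC n
  have e : birkhoffSum T g n x = birkhoffSum T f n x - n * (h x + ε) := by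
    simp [birkhoffSum, g, Finset.sum_sub_distrib, hx, mul_add]
  linarith

theorem eventually_birkhoffSum_div_lt [IsProbabilityMeasure μ] (hT : MeasurePreserving T μ μ)
    {f : X → ℝ} (hfm : Measurable f) (hf : Integrable f μ) :
    ∀ᵐ x ∂μ, ∀ b, (μ[f | almostInvariants μ T]) x < b →
      ∀ᶠ n : ℕ in atTop, birkhoffSum T f n x / n < b := by
  have := fun m : ℕ => birkhoffSum_le_of_condExp hT hfm hf (Nat.one_div_pos_of_nat (α := ℝ) (n := m))
  filter_upwards [ae_all_iff.2 this] with x hx b hb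
  obtain ⟨m, hm⟩ := exists_nat_one_div_lt (sub_pos.2 hb)
  obtain ⟨C, hC⟩ := hx m
  have hlim : Tendsto (fun n : ℕ => ((μ[f | almostInvariants μ T]) x + 1 / ((m : ℝ) + 1)) + C / n)
      atTop (𝓝 (((μ[f | almostInvariants μ T]) x + 1 / ((m : ℝ) + 1)) + 0)) :=
    tendsto_const_nhds.add (tendsto_const_div_atTop_nhds_zero_nat C)
  filter_upwards [hlim.eventually_lt_const (by linarith : _ < b), eventually_gt_atTop 0] with n hn h0
  refine lt_of_le_of_lt ?_ hn
  have h0' : (0 : ℝ) < n := by exact_mod_cast h0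
  rw [div_le_iff₀ h0', add_mul, div_mul_cancel₀ _ h0'.ne', mul_comm _ (n : ℝ)]
  exact hC n

/-- **Birkhoff's pointwise ergodic theorem.** -/
theorem tendsto_birkhoffSum_div [IsProbabilityMeasure μ] (hT : MeasurePreserving T μ μ)
    {f : X → ℝ} (hf : Integrable f μ) :
    ∀ᵐ x ∂μ, Tendsto (fun n : ℕ => birkhoffSum T f n x / n) atTop
      (𝓝 ((μ[f | almostInvariants μ T]) x)) := by
  have main : ∀ g : X → ℝ, Measurable g → Integrable g μ →
      ∀ᵐ x ∂μ, Tendsto (fun n : ℕ => birkhoffSum T g n x / n) atTop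
        (𝓝 ((μ[g | almostInvariants μ T]) x)) := by
    intro g hgm hg
    filter_upwards [eventually_birkhoffSum_div_lt hT hgm hg,
      eventually_birkhoffSum_div_lt hT hgm.neg hg.neg,
      condExp_neg g (almostInvariants μ T)] with x h1 h2 h3
    rw [tendsto_order]
    refine ⟨fun b hb => ?_, fun b hb => h1 b hb⟩
    filter_upwards [h2 (-b) (by rw [h3]; simpa using hb)] with n hn
    rw [birkhoffSum_neg, neg_div] at hn
    linarith
  obtain ⟨g, hgm, hfg⟩ := hf.aestronglyMeasurable
  have hall : ∀ᵐ x ∂μ, ∀ n : ℕ, f (T^[n] x) = g (T^[n] x) :=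
    ae_all_iff.2 fun n => (hT.iterate n).quasiMeasurePreserving.ae hfg
  filter_upwards [main g hgm.measurable (hf.congr hfg), hall,
    condExp_congr_ae (m := almostInvariants μ T) hfg] with x h1 h2 h3
  rw [h3]
  refine h1.congr fun n => ?_
  simp [birkhoffSum, h2]

/-- Birkhoff averages over windows `[u N, v N)` whose end points grow linearly. -/
theorem tendsto_sum_Ico_div {f : ℕ → ℝ} {l b b' : ℝ}
    (hf : Tendsto (fun n : ℕ => (∑ m ∈ Finset.range n, f m) / n) atTop (𝓝 l))
    {u v : ℕ → ℕ} (huv : ∀ N, u N ≤ v N)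
    (hu : Tendsto (fun N : ℕ => (u N : ℝ) / N) atTop (𝓝 b))
    (hv : Tendsto (fun N : ℕ => (v N : ℝ) / N) atTop (𝓝 b'))
    (hu' : Tendsto u atTop atTop ∨ ∀ N, u N = 0) (hv' : Tendsto v atTop atTop) :
    Tendsto (fun N : ℕ => (∑ m ∈ Finset.Ico (u N) (v N), f m) / N) atTop (𝓝 ((b' - b) * l)) := by
  have aux : ∀ (w : ℕ → ℕ) (c : ℝ), Tendsto (fun N : ℕ => (w N : ℝ) / N) atTop (𝓝 c) →
      Tendsto w atTop atTop →
      Tendsto (fun N : ℕ => (∑ m ∈ Finset.range (w N), f m) / N) atTop (𝓝 (c * l)) := by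
    intro w c hw hw'
    refine (hw.mul (hf.comp hw')).congr' ?_
    filter_upwards [hw'.eventually_gt_atTop 0] with N hN
    have : (w N : ℝ) ≠ 0 := by exact_mod_cast hN.ne'
    simp only [Function.comp]
    field_simp
  -- The case of constant zero is the first block, which starts at time 0; there `b = 0`.
  have hu1 : Tendsto (fun N : ℕ => (∑ m ∈ Finset.range (u N), f m) / N) atTop (𝓝 (b * l)) := by
    rcases hu' with h | h
    · exact aux u b hu h
    · simp only [h, Nat.cast_zero, zero_div] at hu
      simp [h, tendsto_nhds_unique hu tendsto_const_nhds]
  rw [sub_mul]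
  refine ((aux v b' hv hv').sub hu1).congr fun N => ?_
  rw [Finset.sum_Ico_eq_sub _ (huv N), sub_div]

end Birkhoff

namespace CountablePartition

/-! ### Cells of countable partitions and measurability. -/

section Cells

variable {X : Type*} {m : MeasurableSpace X} [m0 : MeasurableSpace X]

theorem ext_rel {P P' : CountablePartition X} (h : ∀ x y, P.rel x y ↔ P'.rel x y) : P = P' := by
  have : P.rel = P'.rel := Setoid.ext h
  cases P
  cases P'
  congr

variable (P : CountablePartition X)

theorem mem_cell {x y : X} : y ∈ P.cell x ↔ P.rel y x := Iff.rfl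

theorem mem_cell_self (x : X) : x ∈ P.cell x := P.rel.refl' x

theorem measurableSet_cell (x : X) : MeasurableSet (P.cell x) := P.measurableSet_cell' x

theorem cell_eq_of_rel {x y : X} (h : P.rel x y) : P.cell x = P.cell y := by
  ext z
  exact ⟨fun hz => P.rel.trans' hz h, fun hz => P.rel.trans' hz (P.rel.symm' h)⟩

theorem cell_mem_parts (x : X) : P.cell x ∈ P.parts := ⟨x, rfl⟩

theorem exists_cell_eq {A : Set X} (hA : A ∈ P.parts) : ∃ x, A = P.cell x := hA

theorem cell_eq_of_mem {A : Set X} (hA : A ∈ P.parts) {x : X} (hx : x ∈ A) : P.cell x = A := by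
  obtain ⟨y, rfl⟩ := P.exists_cell_eq hA
  exact P.cell_eq_of_rel hx

theorem measurableSet_of_mem_parts {A : Set X} (hA : A ∈ P.parts) : MeasurableSet A := by
  obtain ⟨y, rfl⟩ := P.exists_cell_eq hA
  exact P.measurableSet_cell y

instance countable_parts : Countable P.parts :=
  have := P.countable_quotient
  (Setoid.quotientEquivClasses P.rel).symm.injective.countable

theorem iUnion_parts : ⋃ A : P.parts, (A : Set X) = Set.univ :=
  Set.eq_univ_of_forall fun x => Set.mem_iUnion.2 ⟨⟨_, P.cell_mem_parts x⟩, P.mem_cell_self x⟩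

theorem pairwise_disjoint_parts :
    Pairwise (Function.onFun Disjoint fun A : P.parts => (A : Set X)) := by
  intro A B hAB
  refine Set.disjoint_left.2 fun x hA hB => hAB (Subtype.ext ?_)
  rw [← P.cell_eq_of_mem A.2 hA, P.cell_eq_of_mem B.2 hB]

theorem lintegral_eq_tsum_parts (μ : Measure X) (f : X → ENNReal) :
    ∫⁻ x, f x ∂μ = ∑' A : P.parts, ∫⁻ x in (A : Set X), f x ∂μ := by
  rw [← lintegral_iUnion (fun A => P.measurableSet_of_mem_parts A.2) P.pairwise_disjoint_parts,
    P.iUnion_parts, setLIntegral_univ]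

theorem tsum_measure_inter_parts (μ : Measure X) {S : Set X} (hS : MeasurableSet S) :
    ∑' A : P.parts, μ (A ∩ S) = μ S := by
  rw [← measure_iUnion (fun A B hAB => (P.pairwise_disjoint_parts hAB).mono
    Set.inter_subset_left Set.inter_subset_left)
    (fun A => (P.measurableSet_of_mem_parts A.2).inter hS), ← Set.iUnion_inter, P.iUnion_parts,
    Set.univ_inter]

theorem measurableSet_sigmaAlgebra_cell (x : X) : MeasurableSet[P.sigmaAlgebra] (P.cell x) :=
  MeasurableSpace.measurableSet_generateFrom (P.cell_mem_parts x)

theorem sigmaAlgebra_le_of_cell (h : ∀ x, MeasurableSet[m] (P.cell x)) :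
    P.sigmaAlgebra ≤ m := by
  refine MeasurableSpace.generateFrom_le fun A hA => ?_
  obtain ⟨y, rfl⟩ := P.exists_cell_eq hA
  exact h y

theorem sigmaAlgebra_le : P.sigmaAlgebra ≤ m0 :=
  P.sigmaAlgebra_le_of_cell P.measurableSet_cell

/-- A saturated set is a union of cells, and there are only countably many cells. -/
theorem measurableSet_sigmaAlgebra_of_saturated {S : Set X}
    (h : ∀ x y, P.rel x y → x ∈ S → y ∈ S) : MeasurableSet[P.sigmaAlgebra] S := by
  have : S = ⋃ A : {A : P.parts // (A : Set X) ⊆ S}, ((A : P.parts) : Set X) := by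
    ext x
    simp only [Set.mem_iUnion]
    refine ⟨fun hx => ⟨⟨⟨_, P.cell_mem_parts x⟩, fun y hy => h x y (P.rel.symm' hy) hx⟩,
      P.mem_cell_self x⟩, ?_⟩
    rintro ⟨A, hA⟩
    exact A.2 hA
  rw [this]
  exact MeasurableSet.iUnion fun A => MeasurableSpace.measurableSet_generateFrom A.1.2

theorem saturated_of_measurableSet_sigmaAlgebra {S : Set X}
    (hS : MeasurableSet[P.sigmaAlgebra] S) {x y : X} (h : P.rel x y) : x ∈ S ↔ y ∈ S := by
  induction S, hS using MeasurableSpace.generateFrom_induction with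
  | hC A hA _ =>
    obtain ⟨z, rfl⟩ := P.exists_cell_eq hA
    exact ⟨fun hx => P.rel.trans' (P.rel.symm' h) hx, fun hy => P.rel.trans' h hy⟩
  | empty => simp
  | compl t _ ih => simp [ih]
  | iUnion s _ ih => simp [ih]

theorem measurable_sigmaAlgebra_of_const {β : Type*} [MeasurableSpace β] {f : X → β}
    (h : ∀ x y, P.rel x y → f x = f y) : Measurable[P.sigmaAlgebra] f := fun S _ =>
  P.measurableSet_sigmaAlgebra_of_saturated fun x y hxy hx => by
    rw [Set.mem_preimage] at hx ⊢
    rwa [← h x y hxy]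

theorem eq_of_measurable_sigmaAlgebra {β : Type*} [MeasurableSpace β] [MeasurableSingletonClass β]
    {f : X → β} (hf : Measurable[P.sigmaAlgebra] f) {x y : X} (h : P.rel x y) : f x = f y := by
  have := (P.saturated_of_measurableSet_sigmaAlgebra (hf (measurableSet_singleton (f y))) h).2 rfl
  exact this

theorem sigmaAlgebra_mono {P P' : CountablePartition X} (h : ∀ x y, P.rel x y → P'.rel x y) :
    P'.sigmaAlgebra ≤ P.sigmaAlgebra :=
  P'.sigmaAlgebra_le_of_cell fun _ => P.measurableSet_sigmaAlgebra_of_saturated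
    fun x y hxy hx => P'.rel.trans' (P'.rel.symm' (h x y hxy)) hx

theorem comap_sigmaAlgebra_le {T : X → X} (hT : Measurable T) :
    MeasurableSpace.comap T P.sigmaAlgebra ≤ (P.preimage T hT).sigmaAlgebra := by
  rw [sigmaAlgebra, MeasurableSpace.comap_generateFrom]
  refine MeasurableSpace.generateFrom_le ?_
  rintro _ ⟨A, hA, rfl⟩
  obtain ⟨z, rfl⟩ := P.exists_cell_eq hA
  exact measurableSet_sigmaAlgebra_of_saturated _
    fun x y hxy hx => P.rel.trans' (P.rel.symm' hxy) hx

/-- A function given by a measurable formula on each cell is measurable. -/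
theorem measurable_of_forall_parts {β : Type*} [MeasurableSpace β]
    (hP : P.sigmaAlgebra ≤ m) {f : X → β} (g : Set X → X → β)
    (hg : ∀ A ∈ P.parts, Measurable[m] (g A)) (hfg : ∀ x, f x = g (P.cell x) x) :
    Measurable[m] f := by
  intro S hS
  have : f ⁻¹' S = ⋃ A : P.parts, (A : Set X) ∩ g A ⁻¹' S := by
    ext x
    simp only [Set.mem_preimage, Set.mem_iUnion, Set.mem_inter_iff]
    constructor
    · intro hx
      exact ⟨⟨_, P.cell_mem_parts x⟩, P.mem_cell_self x, by rwa [← hfg]⟩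
    · rintro ⟨A, hA, hx⟩
      rwa [hfg, P.cell_eq_of_mem A.2 hA]
  rw [this]
  exact MeasurableSet.iUnion fun A =>
    (hP _ (MeasurableSpace.measurableSet_generateFrom A.2)).inter (hg A A.2 hS)

theorem ae_iff_forall_parts {μ : Measure X} {p : X → Prop} :
    (∀ᵐ x ∂μ, p x) ↔ ∀ A ∈ P.parts, ∀ᵐ x ∂μ, x ∈ A → p x := by
  refine ⟨fun h A _ => h.mono fun x hx _ => hx, fun h => ?_⟩
  have h' : ∀ᵐ x ∂μ, ∀ A : P.parts, x ∈ (A : Set X) → p x := ae_all_iff.2 fun A => h A A.2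
  filter_upwards [h'] with x hx
  exact hx ⟨_, P.cell_mem_parts x⟩ (P.mem_cell_self x)

/-- The null cells are countably many. This keeps logarithms and quotients of cell measures away
from their default values at 0. -/
theorem ae_measure_cell_ne_zero (μ : Measure X) : ∀ᵐ x ∂μ, μ (P.cell x) ≠ 0 := by
  rw [P.ae_iff_forall_parts]
  intro A hA
  by_cases h : μ A = 0
  · filter_upwards [measure_eq_zero_iff_ae_notMem.1 h] with x hx hx'
    exact absurd hx' hx
  · exact Eventually.of_forall fun x hx => by rwa [P.cell_eq_of_mem hA hx]

/-- The common refinement of two partitions. -/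
def inf (P P' : CountablePartition X) : CountablePartition X := join fun b : Bool => cond b P P'

theorem inf_rel {P P' : CountablePartition X} {x y : X} :
    (P.inf P').rel x y ↔ P.rel x y ∧ P'.rel x y := by
  refine Iff.trans (b := ∀ b : Bool, (cond b P P').rel x y) Iff.rfl ?_
  rw [Bool.forall_bool]
  exact and_comm

theorem inf_cell {P P' : CountablePartition X} (x : X) :
    (P.inf P').cell x = P.cell x ∩ P'.cell x := by
  ext y
  exact inf_rel

end Cells

/-! ### Conditional information and conditional entropy. -/

section CondExp

variable {X : Type*} {m 𝒜 : MeasurableSpace X} [m0 : MeasurableSpace X] {μ : Measure X}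

/-- The conditional probability `μ(P(x)|𝒜)(x)`. -/
noncomputable def condProb {X : Type*} (𝒜 : MeasurableSpace X) [MeasurableSpace X]
    (P : CountablePartition X) (μ : Measure X) (x : X) : ℝ :=
  (μ[(P.cell x).indicator (fun _ => (1 : ℝ)) | 𝒜]) x

theorem condInfo_eq (P : CountablePartition X) (x : X) : condInfo 𝒜 P μ x = -Real.log (condProb 𝒜 P μ x) := rfl

theorem measurable_condProb (P : CountablePartition X) (hP : P.sigmaAlgebra ≤ m) (h : 𝒜 ≤ m) :
    Measurable[m] (condProb 𝒜 P μ) :=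
  P.measurable_of_forall_parts hP (fun A => μ[A.indicator (fun _ => (1 : ℝ)) | 𝒜])
    (fun _ _ => stronglyMeasurable_condExp.measurable.mono h le_rfl) fun _ => rfl

theorem measurable_condInfo (P : CountablePartition X) (h𝒜 : 𝒜 ≤ m0) : Measurable (condInfo 𝒜 P μ) :=
  (Real.measurable_log.comp (P.measurable_condProb P.sigmaAlgebra_le h𝒜)).neg

theorem measurable_measure_cell (P : CountablePartition X) : Measurable fun x => μ (P.cell x) :=
  (P.measurable_sigmaAlgebra_of_const fun x y h => by rw [P.cell_eq_of_rel h]).mono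
    P.sigmaAlgebra_le le_rfl

theorem measurable_info (P : CountablePartition X) : Measurable (P.info μ) :=
  (P.measurable_sigmaAlgebra_of_const fun x y h => by
    rw [info, info, P.cell_eq_of_rel h]).mono P.sigmaAlgebra_le le_rfl

variable [IsProbabilityMeasure μ]

theorem integrable_indicator_one {B : Set X} (hB : MeasurableSet B) :
    Integrable (B.indicator fun _ => (1 : ℝ)) μ := (integrable_const _).indicator hB

theorem condExp_indicator_mem_Icc (h𝒜 : 𝒜 ≤ m0) {B : Set X} (hB : MeasurableSet B) :
    ∀ᵐ x ∂μ, (μ[B.indicator (fun _ => (1 : ℝ)) | 𝒜]) x ∈ Set.Icc (0 : ℝ) 1 := by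
  have h1 : 0 ≤ᵐ[μ] μ[B.indicator (fun _ => (1 : ℝ)) | 𝒜] :=
    condExp_nonneg (Eventually.of_forall fun x => Set.indicator_nonneg (by simp) x)
  have h2 : μ[B.indicator (fun _ => (1 : ℝ)) | 𝒜] ≤ᵐ[μ] μ[fun _ => (1 : ℝ) | 𝒜] :=
    condExp_mono (integrable_indicator_one hB) (integrable_const _)
      (Eventually.of_forall fun x => Set.indicator_le_self' (by simp) x)
  rw [condExp_const h𝒜] at h2
  filter_upwards [h1, h2] with x hx1 hx2
  exact ⟨hx1, hx2⟩

/-- The measures `μ.restrict B` and `E[1_B|𝒜] μ` agree on `𝒜`. Working in `ENNReal` frees `g` from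
any integrability condition, which matters for reciprocals of conditional probabilities. -/
theorem setLIntegral_eq_lintegral_mul_condExp (h𝒜 : 𝒜 ≤ m0) {B : Set X} (hB : MeasurableSet B)
    {g : X → ENNReal} (hg : Measurable[𝒜] g) :
    ∫⁻ x in B, g x ∂μ =
      ∫⁻ x, g x * ENNReal.ofReal ((μ[B.indicator (fun _ => (1 : ℝ)) | 𝒜]) x) ∂μ := by
  set e := μ[B.indicator (fun _ => (1 : ℝ)) | 𝒜]
  have hem : Measurable[𝒜] fun x => ENNReal.ofReal (e x) :=
    ENNReal.measurable_ofReal.comp stronglyMeasurable_condExp.measurable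
  have key : (μ.restrict B).trim h𝒜 = (μ.withDensity fun x => ENNReal.ofReal (e x)).trim h𝒜 := by
    refine @Measure.ext _ 𝒜 _ _ fun S hS => ?_
    have hS0 := h𝒜 S hS
    rw [trim_measurableSet_eq h𝒜 hS, trim_measurableSet_eq h𝒜 hS, Measure.restrict_apply hS0,
      withDensity_apply _ hS0, ← ofReal_integral_eq_lintegral_ofReal integrable_condExp.integrableOn,
      setIntegral_condExp h𝒜 (integrable_indicator_one hB) hS, setIntegral_indicator hB]
    · simp
    · exact ae_restrict_of_ae ((condExp_indicator_mem_Icc h𝒜 hB).mono fun x hx => hx.1)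
  rw [← lintegral_trim h𝒜 hg, key, lintegral_trim h𝒜 hg,
    lintegral_withDensity_eq_lintegral_mul₀ (hem.mono h𝒜 le_rfl).aemeasurable
      (hg.mono h𝒜 le_rfl).aemeasurable]
  simp [mul_comm]

variable (P : CountablePartition X)

/-- For a cell `A` with conditional probability `e`, testing against the indicator of `{e ≤ 0}`
shows that `A ∩ {e ≤ 0}` is null. -/
theorem condProb_pos (h𝒜 : 𝒜 ≤ m0) : ∀ᵐ x ∂μ, 0 < condProb 𝒜 P μ x := by
  rw [P.ae_iff_forall_parts]
  intro A hA
  have hAm := P.measurableSet_of_mem_parts hA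
  set e := μ[A.indicator (fun _ => (1 : ℝ)) | 𝒜]
  have hS : MeasurableSet[𝒜] {x | e x ≤ 0} :=
    measurableSet_le stronglyMeasurable_condExp.measurable measurable_const
  have h := setLIntegral_eq_lintegral_mul_condExp (μ := μ) h𝒜 hAm
    (g := {x | e x ≤ 0}.indicator 1) (Measurable.indicator (m := 𝒜) (@measurable_const _ _ _ 𝒜 1) hS)
  have h0 : ∫⁻ x, {x | e x ≤ 0}.indicator 1 x * ENNReal.ofReal (e x) ∂μ = 0 := by
    rw [← lintegral_zero (μ := μ)]
    congr 1 with x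
    by_cases hx : e x ≤ 0
    · simp [ENNReal.ofReal_of_nonpos hx]
    · simp [hx]
  rw [h0, lintegral_indicator_one (h𝒜 _ hS), Measure.restrict_apply (h𝒜 _ hS)] at h
  filter_upwards [measure_eq_zero_iff_ae_notMem.1 h] with x hx hxA
  have : condProb 𝒜 P μ x = e x := by rw [condProb, P.cell_eq_of_mem hA hxA]
  rw [this]
  by_contra hcon
  exact hx ⟨not_lt.1 hcon, hxA⟩

theorem condProb_le_one (h𝒜 : 𝒜 ≤ m0) : ∀ᵐ x ∂μ, condProb 𝒜 P μ x ≤ 1 := by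
  rw [P.ae_iff_forall_parts]
  intro A hA
  filter_upwards [condExp_indicator_mem_Icc (μ := μ) h𝒜 (P.measurableSet_of_mem_parts hA)]
    with x hx hxA
  rw [condProb, P.cell_eq_of_mem hA hxA]
  exact hx.2

theorem condInfo_nonneg (h𝒜 : 𝒜 ≤ m0) : ∀ᵐ x ∂μ, 0 ≤ condInfo 𝒜 P μ x := by
  filter_upwards [P.condProb_pos (μ := μ) h𝒜, P.condProb_le_one (μ := μ) h𝒜] with x h0 h1
  rw [condInfo_eq, neg_nonneg]
  exact Real.log_nonpos h0.le h1

theorem tsum_condExp_parts_le_one (h𝒜 : 𝒜 ≤ m0) :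
    ∀ᵐ x ∂μ, ∑' A : P.parts,
      ENNReal.ofReal ((μ[(A : Set X).indicator (fun _ => (1 : ℝ)) | 𝒜]) x) ≤ 1 := by
  have h1 : ∀ᵐ x ∂μ, ∀ F : Finset P.parts,
      ∑ A ∈ F, (μ[(A : Set X).indicator (fun _ => (1 : ℝ)) | 𝒜]) x ≤ 1 := by
    rw [ae_all_iff]
    intro F
    have hi : ∀ A ∈ F, Integrable ((A : Set X).indicator fun _ => (1 : ℝ)) μ :=
      fun A _ => integrable_indicator_one (P.measurableSet_of_mem_parts A.2)
    have hle : ∑ A ∈ F, (A : Set X).indicator (fun _ => (1 : ℝ)) ≤ᵐ[μ] fun _ => (1 : ℝ) := by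
      refine Eventually.of_forall fun x => ?_
      have hz : ∀ A ∈ F, A ≠ (⟨_, P.cell_mem_parts x⟩ : P.parts) →
          (A : Set X).indicator (fun _ => (1 : ℝ)) x = 0 := by
        intro A _ hA
        refine Set.indicator_of_notMem (fun hx => hA (Subtype.ext ?_)) _
        exact (P.cell_eq_of_mem A.2 hx).symm
      rw [Finset.sum_apply]
      by_cases hmem : (⟨_, P.cell_mem_parts x⟩ : P.parts) ∈ F
      · rw [Finset.sum_eq_single_of_mem _ hmem hz]
        exact Set.indicator_le_self' (by simp) x
      · rw [Finset.sum_eq_zero fun A hA => hz A hA fun h => hmem (h ▸ hA)]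
        exact zero_le_one
    have h2 := condExp_mono (m := 𝒜) (integrable_finsetSum' F hi) (integrable_const _) hle
    rw [condExp_const h𝒜] at h2
    filter_upwards [h2, condExp_finsetSum hi 𝒜] with x hx1 hx2
    rw [hx2, Finset.sum_apply] at hx1
    exact hx1
  have h0 : ∀ᵐ x ∂μ, ∀ A : P.parts,
      0 ≤ (μ[(A : Set X).indicator (fun _ => (1 : ℝ)) | 𝒜]) x :=
    ae_all_iff.2 fun A => (condExp_indicator_mem_Icc h𝒜
      (P.measurableSet_of_mem_parts A.2)).mono fun x hx => hx.1
  filter_upwards [h0, h1] with x hx0 hx1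
  refine ENNReal.summable.tsum_le_of_sum_le fun F => ?_
  rw [← ENNReal.ofReal_sum_of_nonneg fun A _ => hx0 A]
  exact ENNReal.ofReal_le_one.2 (hx1 F)

/-- Conditional expectations given a countable partition are averages over the cells. -/
theorem condExp_indicator_sigmaAlgebra {B : Set X} (hB : MeasurableSet B) :
    ∀ᵐ x ∂μ, (μ[B.indicator (fun _ => (1 : ℝ)) | P.sigmaAlgebra]) x =
      μ.real (B ∩ P.cell x) / μ.real (P.cell x) := by
  filter_upwards [P.ae_measure_cell_ne_zero μ] with x hx
  set e := μ[B.indicator (fun _ => (1 : ℝ)) | P.sigmaAlgebra]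
  have h := setIntegral_condExp (μ := μ) P.sigmaAlgebra_le (integrable_indicator_one hB)
    (P.measurableSet_sigmaAlgebra_cell x)
  rw [setIntegral_indicator hB, setIntegral_congr_fun (g := fun _ => e x) (P.measurableSet_cell x)
    fun y hy => P.eq_of_measurable_sigmaAlgebra stronglyMeasurable_condExp.measurable hy] at h
  simp only [setIntegral_const, smul_eq_mul, mul_one] at h
  rw [Set.inter_comm, ← h, mul_div_cancel_left₀]
  rw [measureReal_def, ENNReal.toReal_ne_zero]
  exact ⟨hx, measure_ne_top _ _⟩

theorem condProb_sigmaAlgebra (P' : CountablePartition X) :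
    ∀ᵐ x ∂μ, condProb P'.sigmaAlgebra P μ x =
      μ.real (P.cell x ∩ P'.cell x) / μ.real (P'.cell x) := by
  rw [P.ae_iff_forall_parts]
  intro A hA
  filter_upwards [P'.condExp_indicator_sigmaAlgebra (μ := μ) (P.measurableSet_of_mem_parts hA)]
    with x hx hxA
  rw [condProb, P.cell_eq_of_mem hA hxA, hx]

theorem measureReal_cell_pos (x : X) (hx : μ (P.cell x) ≠ 0) : 0 < μ.real (P.cell x) :=
  ENNReal.toReal_pos hx (measure_ne_top _ _)

theorem info_inf (P' : CountablePartition X) :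
    ∀ᵐ x ∂μ, (P.inf P').info μ x = condInfo P'.sigmaAlgebra P μ x + P'.info μ x := by
  filter_upwards [P.condProb_sigmaAlgebra (μ := μ) P', P'.ae_measure_cell_ne_zero μ,
    (P.inf P').ae_measure_cell_ne_zero μ] with x h1 h2 h3
  rw [condInfo_eq, h1, info, info, inf_cell, Real.log_div]
  · ring
  · rw [← inf_cell]
    exact (measureReal_cell_pos _ x h3).ne'
  · exact (measureReal_cell_pos _ x h2).ne'

theorem info_nonneg (x : X) : 0 ≤ P.info μ x := by
  rw [info, neg_nonneg]
  exact Real.log_nonpos measureReal_nonneg measureReal_le_one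

theorem entropy_eq_lintegral_info : P.entropy μ = ∫⁻ x, ENNReal.ofReal (P.info μ x) ∂μ := by
  rw [P.lintegral_eq_tsum_parts, entropy]
  congr 1 with A
  rw [setLIntegral_congr_fun (g := fun _ => ENNReal.ofReal (-Real.log (μ.real (A : Set X))))
    (P.measurableSet_of_mem_parts A.2)
    (fun x hx => by simp only [info, P.cell_eq_of_mem A.2 hx]), setLIntegral_const,
    ← ofReal_measureReal (μ := μ), ← ENNReal.ofReal_mul' measureReal_nonneg, Real.negMulLog]
  congr 1
  ring

/-- The conditional entropy `H_μ(P|𝒜) = ∫ I_μ(P|𝒜) dμ`. -/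
noncomputable def condEntropy {X : Type*} (𝒜 : MeasurableSpace X) [MeasurableSpace X]
    (P : CountablePartition X) (μ : Measure X) : ENNReal :=
  ∫⁻ x, ENNReal.ofReal (condInfo 𝒜 P μ x) ∂μ

theorem entropy_inf (P' : CountablePartition X) :
    (P.inf P').entropy μ = condEntropy P'.sigmaAlgebra P μ + P'.entropy μ := by
  rw [entropy_eq_lintegral_info, entropy_eq_lintegral_info, condEntropy,
    ← lintegral_add_right _ P'.measurable_info.ennreal_ofReal]
  refine lintegral_congr_ae ?_
  filter_upwards [P.info_inf P', P.condInfo_nonneg (μ := μ) P'.sigmaAlgebra_le] with x h1 h2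
  rw [h1, ENNReal.ofReal_add h2 (P'.info_nonneg x)]

/-- Integrating `-log e` over a cell is integrating `-e log e` over the whole space. The new
integrand is a bounded continuous function of `e ∈ [0, 1]`, which opens the way to Jensen's
inequality and to limits. -/
theorem condEntropy_eq_tsum (h𝒜 : 𝒜 ≤ m0) :
    condEntropy 𝒜 P μ = ∑' A : P.parts, ∫⁻ x, ENNReal.ofReal
      (Real.negMulLog ((μ[(A : Set X).indicator (fun _ => (1 : ℝ)) | 𝒜]) x)) ∂μ := by
  rw [condEntropy, P.lintegral_eq_tsum_parts]
  congr 1 with A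
  have hA := P.measurableSet_of_mem_parts A.2
  rw [setLIntegral_congr_fun (g := fun x => ENNReal.ofReal
    (-Real.log ((μ[(A : Set X).indicator (fun _ => (1 : ℝ)) | 𝒜]) x))) hA
    (fun x hx => by simp only [condInfo, P.cell_eq_of_mem A.2 hx]),
    setLIntegral_eq_lintegral_mul_condExp h𝒜 hA]
  · refine lintegral_congr_ae ?_
    filter_upwards [condExp_indicator_mem_Icc (μ := μ) h𝒜 hA] with x hx
    rw [← ENNReal.ofReal_mul' hx.1, Real.negMulLog]
    congr 1
    ring
  · exact (Real.measurable_log.comp stronglyMeasurable_condExp.measurable).neg.ennreal_ofReal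

theorem negMulLog_le_one {x : ℝ} (h : x ∈ Set.Icc (0 : ℝ) 1) : Real.negMulLog x ≤ 1 := by
  have := Real.negMulLog_le_one_sub_self h.1
  linarith [h.1]

/-- Jensen's inequality for the concave function `Real.negMulLog`. -/
theorem lintegral_negMulLog_condExp_le (h𝒜 : 𝒜 ≤ m0) {A : Set X} (hA : MeasurableSet A) :
    ∫⁻ x, ENNReal.ofReal
      (Real.negMulLog ((μ[A.indicator (fun _ => (1 : ℝ)) | 𝒜]) x)) ∂μ ≤
      ENNReal.ofReal (Real.negMulLog (μ.real A)) := by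
  have hI := condExp_indicator_mem_Icc (μ := μ) h𝒜 hA
  have hm : Measurable fun x => Real.negMulLog ((μ[A.indicator (fun _ => (1 : ℝ)) | 𝒜]) x) :=
    Real.continuous_negMulLog.measurable.comp
      (stronglyMeasurable_condExp.measurable.mono h𝒜 le_rfl)
  have hint : Integrable
      (fun x => Real.negMulLog ((μ[A.indicator (fun _ => (1 : ℝ)) | 𝒜]) x)) μ := by
    refine (integrable_const (1 : ℝ)).mono' hm.aestronglyMeasurable ?_
    filter_upwards [hI] with x hx
    rw [Real.norm_eq_abs, abs_of_nonneg (Real.negMulLog_nonneg hx.1 hx.2)]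
    exact negMulLog_le_one hx
  rw [← ofReal_integral_eq_lintegral_ofReal hint
    (hI.mono fun x hx => Real.negMulLog_nonneg hx.1 hx.2)]
  refine ENNReal.ofReal_le_ofReal ?_
  have := Real.concaveOn_negMulLog.le_map_integral Real.continuous_negMulLog.continuousOn
    isClosed_Ici (hI.mono fun x hx => hx.1) integrable_condExp hint
  rwa [integral_condExp h𝒜, integral_indicator_const _ hA, smul_eq_mul, mul_one] at this

theorem condEntropy_le_entropy (h𝒜 : 𝒜 ≤ m0) : condEntropy 𝒜 P μ ≤ P.entropy μ := by
  rw [P.condEntropy_eq_tsum h𝒜]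
  exact ENNReal.tsum_le_tsum fun A =>
    lintegral_negMulLog_condExp_le h𝒜 (P.measurableSet_of_mem_parts A.2)

theorem condEntropy_ne_top (h𝒜 : 𝒜 ≤ m0) (hP : P.entropy μ < ⊤) : condEntropy 𝒜 P μ ≠ ⊤ :=
  ((P.condEntropy_le_entropy h𝒜).trans_lt hP).ne

/-- Dominated convergence twice. The sum over cells is an integral against counting measure,
dominated by the terms of the finite entropy; inside each cell Lévy's upward theorem gives pointwise
convergence, dominated by 1. -/
theorem tendsto_condEntropy (ℱ : Filtration ℕ m0) (hP : P.entropy μ ≠ ⊤) :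
    Tendsto (fun n => condEntropy (ℱ n) P μ) atTop (𝓝 (condEntropy (⨆ n, ℱ n) P μ)) := by
  have hle : ⨆ n, ℱ n ≤ m0 := iSup_le fun n => ℱ.le n
  simp only [P.condEntropy_eq_tsum hle, P.condEntropy_eq_tsum (ℱ.le _)]
  let _ : MeasurableSpace P.parts := ⊤
  simp only [← MeasureTheory.lintegral_count]
  refine tendsto_lintegral_of_dominated_convergence
    (fun A : P.parts => ENNReal.ofReal (Real.negMulLog (μ.real (A : Set X))))
    (fun n => measurable_from_top) ?_ ?_ ?_
  · exact fun n => Eventually.of_forall fun A =>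
      lintegral_negMulLog_condExp_le (ℱ.le n) (P.measurableSet_of_mem_parts A.2)
  · rw [MeasureTheory.lintegral_count]
    exact hP
  · refine Eventually.of_forall fun A => ?_
    have hA := P.measurableSet_of_mem_parts A.2
    refine tendsto_lintegral_of_dominated_convergence (fun _ => 1) (fun n => ?_) (fun n => ?_)
      (by simp) ?_
    · exact (Real.continuous_negMulLog.measurable.comp
        (stronglyMeasurable_condExp.measurable.mono (ℱ.le n) le_rfl)).ennreal_ofReal
    · filter_upwards [condExp_indicator_mem_Icc (μ := μ) (ℱ.le n) hA] with x hx
      exact ENNReal.ofReal_le_one.2 (negMulLog_le_one hx)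
    · filter_upwards [tendsto_ae_condExp (μ := μ) (ℱ := ℱ)
        ((A : Set X).indicator fun _ => (1 : ℝ))] with x hx
      exact (ENNReal.continuous_ofReal.tendsto _).comp
        ((Real.continuous_negMulLog.tendsto _).comp hx)

theorem integrable_condInfo (h𝒜 : 𝒜 ≤ m0) (hP : P.entropy μ ≠ ⊤) :
    Integrable (condInfo 𝒜 P μ) μ := by
  refine ⟨(P.measurable_condInfo h𝒜).aestronglyMeasurable, ?_⟩
  rw [hasFiniteIntegral_iff_ofReal (P.condInfo_nonneg h𝒜)]
  exact (P.condEntropy_le_entropy h𝒜).trans_lt hP.lt_top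

theorem integral_condInfo (h𝒜 : 𝒜 ≤ m0) :
    ∫ x, condInfo 𝒜 P μ x ∂μ = (condEntropy 𝒜 P μ).toReal :=
  integral_eq_lintegral_of_nonneg_ae (P.condInfo_nonneg h𝒜)
    (P.measurable_condInfo h𝒜).aestronglyMeasurable

theorem entropy_inf_lt_top {P' : CountablePartition X} (h : P.entropy μ < ⊤)
    (h' : P'.entropy μ < ⊤) : (P.inf P').entropy μ < ⊤ := by
  rw [entropy_inf]
  exact ENNReal.add_lt_top.2 ⟨(P.condEntropy_le_entropy P'.sigmaAlgebra_le).trans_lt h, h'⟩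

theorem entropy_of_forall_rel (h : ∀ x y, P.rel x y) : P.entropy μ = 0 := by
  have : ∀ x, P.cell x = Set.univ := fun x => Set.eq_univ_of_forall fun y => h y x
  simp [entropy_eq_lintegral_info, info, this]

theorem entropy_preimage {T : X → X} (hT : MeasurePreserving T μ μ) :
    (P.preimage T hT.measurable).entropy μ = P.entropy μ := by
  rw [entropy_eq_lintegral_info, entropy_eq_lintegral_info,
    ← hT.lintegral_comp P.measurable_info.ennreal_ofReal]
  congr 1 with x
  have : (P.preimage T hT.measurable).cell x = T ⁻¹' P.cell (T x) := rfl
  rw [info, info, this, measureReal_def, measureReal_def,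
    hT.measure_preimage (P.measurableSet_cell _).nullMeasurableSet]

theorem entropy_join_lt_top {ι : Type*} [Finite ι] (α : ι → CountablePartition X) (p : ι → Prop)
    (h : ∀ i, (α i).entropy μ < ⊤) : (join fun i : {i // p i} => α i).entropy μ < ⊤ := by
  -- Quantifying over every `Q` with the right relation avoids transporting joins between the index
  -- types met in the induction.
  have : ∀ (s : Set ι) (hs : s.Finite), ∀ Q : CountablePartition X,
      (∀ x y, Q.rel x y ↔ ∀ i ∈ s, (α i).rel x y) → Q.entropy μ < ⊤ := by
    intro s hs
    induction s, hs using Set.Finite.induction_on with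
    | empty =>
      intro Q hQ
      rw [Q.entropy_of_forall_rel fun x y => by simp [hQ]]
      exact ENNReal.zero_lt_top
    | @insert i s _ hs ih =>
      intro Q hQ
      have := hs.to_subtype
      have e : Q = (α i).inf (join fun i : s => α i) := by
        refine ext_rel fun x y => ?_
        rw [inf_rel, hQ]
        refine Set.forall_mem_insert.trans (and_congr_right fun _ => ?_)
        exact ⟨fun h i => h i i.2, fun h i hi => h ⟨i, hi⟩⟩
      rw [e]
      exact entropy_inf_lt_top _ (h i) (ih _ fun x y =>
        ⟨fun h i hi => h ⟨i, hi⟩, fun h i => h i i.2⟩)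
  exact this {i | p i} (Set.toFinite _) _ fun x y =>
    ⟨fun h i hi => h ⟨i, hi⟩, fun h i => h i i.2⟩

end CondExp

end CountablePartition

namespace CountablePartition

/-! ### Entropy of iterated joins and the dynamical entropy. -/

section Dynamics

variable {X : Type*} [m0 : MeasurableSpace X] {T : X → X} (hT : Measurable T)
  (P : CountablePartition X)

theorem iterJoin_rel {n : ℕ} {x y : X} :
    (P.iterJoin T hT n).rel x y ↔ ∀ j < n, P.rel (T^[j] x) (T^[j] y) :=
  ⟨fun h j hj => h ⟨j, hj⟩, fun h j => h j j.2⟩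

theorem preimage_iterJoin_rel {n : ℕ} {x y : X} :
    ((P.iterJoin T hT n).preimage T hT).rel x y ↔
      ∀ j < n, P.rel (T^[j + 1] x) (T^[j + 1] y) := P.iterJoin_rel hT

theorem iterJoin_succ (n : ℕ) :
    P.iterJoin T hT (n + 1) = P.inf ((P.iterJoin T hT n).preimage T hT) := by
  refine ext_rel fun x y => ?_
  rw [iterJoin_rel, inf_rel, preimage_iterJoin_rel]
  constructor
  · exact fun h => ⟨h 0 n.succ_pos, fun j hj => h (j + 1) (by omega)⟩
  · rintro ⟨h0, h⟩ (_ | j) hj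
    exacts [h0, h j (by omega)]

theorem past_le : P.past T hT ≤ m0 := iSup_le fun _ => sigmaAlgebra_le _

/-- The filtration `⋁_{j=1}^n T^{-j}P`, `n ∈ ℕ`. -/
def pastFiltration : Filtration ℕ m0 where
  seq n := ((P.iterJoin T hT n).preimage T hT).sigmaAlgebra
  mono' n n' h := sigmaAlgebra_mono fun x y hxy => by
    rw [preimage_iterJoin_rel] at hxy ⊢
    exact fun j hj => hxy j (hj.trans_le h)
  le' _ := sigmaAlgebra_le _

theorem iSup_pastFiltration : ⨆ n, P.pastFiltration hT n = P.past T hT := by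
  refine le_antisymm (iSup_le fun n => ?_) (iSup_le fun n => ?_)
  · refine sigmaAlgebra_le_of_cell _ fun x => ?_
    have : ((P.iterJoin T hT n).preimage T hT).cell x =
        ⋂ j : Fin n, (P.preimage T^[(j : ℕ) + 1] (hT.iterate (j + 1))).cell x := by
      ext y
      rw [mem_cell, preimage_iterJoin_rel, Set.mem_iInter]
      exact ⟨fun h j => h j j.2, fun h j hj => h ⟨j, hj⟩⟩
    rw [this]
    exact MeasurableSet.iInter fun j =>
      le_iSup (fun n : ℕ => (P.preimage T^[n + 1] (hT.iterate (n + 1))).sigmaAlgebra) (j : ℕ) _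
        (measurableSet_sigmaAlgebra_cell _ x)
  · refine le_trans (sigmaAlgebra_mono fun x y hxy => ?_) (le_iSup (fun n => P.pastFiltration hT n) (n + 1))
    rw [preimage_iterJoin_rel] at hxy
    exact hxy n n.lt_succ_self

variable {μ : Measure X} [IsProbabilityMeasure μ]

theorem entropy_iterJoin_succ (hT : MeasurePreserving T μ μ) (n : ℕ) :
    (P.iterJoin T hT.measurable (n + 1)).entropy μ =
      condEntropy (P.pastFiltration hT.measurable n) P μ +
        (P.iterJoin T hT.measurable n).entropy μ := by
  rw [iterJoin_succ, entropy_inf, entropy_preimage _ hT]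
  rfl

theorem entropy_iterJoin_toReal (hT : MeasurePreserving T μ μ) (hP : P.entropy μ < ⊤) (n : ℕ) :
    (P.iterJoin T hT.measurable n).entropy μ < ⊤ ∧
    ((P.iterJoin T hT.measurable n).entropy μ).toReal =
      ∑ m ∈ Finset.range n, (condEntropy (P.pastFiltration hT.measurable m) P μ).toReal := by
  induction n with
  | zero =>
    rw [entropy_of_forall_rel _ fun x y => by simp [iterJoin_rel]]
    simp
  | succ n ih =>
    have h := P.condEntropy_ne_top ((P.pastFiltration hT.measurable).le n) hP
    rw [P.entropy_iterJoin_succ hT, Finset.sum_range_succ, ← ih.2, ENNReal.toReal_add h ih.1.ne,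
      add_comm _ (ENNReal.toReal _)]
    exact ⟨ENNReal.add_lt_top.2 ⟨h.lt_top, ih.1⟩, rfl⟩

theorem tendsto_condEntropy_pastFiltration (hP : P.entropy μ < ⊤) :
    Tendsto (fun n => (condEntropy (P.pastFiltration hT n) P μ).toReal) atTop
      (𝓝 (condEntropy (P.past T hT) P μ).toReal) := by
  have h := P.tendsto_condEntropy (P.pastFiltration hT) hP.ne
  rw [iSup_pastFiltration] at h
  exact (ENNReal.tendsto_toReal (P.condEntropy_ne_top (P.past_le hT) hP)).comp h

/-- The chain rule makes the entropy of the iterated join a sum of conditional entropies given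
finite pasts; these converge, so their Cesàro means do. -/
theorem tendsto_entropy_iterJoin_div (hT : MeasurePreserving T μ μ) (hP : P.entropy μ < ⊤) :
    Tendsto (fun n : ℕ => ((P.iterJoin T hT.measurable n).entropy μ).toReal / n) atTop
      (𝓝 (condEntropy (P.past T hT.measurable) P μ).toReal) := by
  refine (P.tendsto_condEntropy_pastFiltration hT.measurable hP).cesaro.congr fun n => ?_
  rw [(P.entropy_iterJoin_toReal hT hP n).2, div_eq_inv_mul]

theorem dynEntropy_eq (hT : MeasurePreserving T μ μ) (hP : P.entropy μ < ⊤) :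
    P.dynEntropy μ T hT.measurable = (condEntropy (P.past T hT.measurable) P μ).toReal :=
  (P.tendsto_entropy_iterJoin_div hT hP).limUnder_eq

end Dynamics

/-! ### Likelihood ratios and two-sided bounds on the information. -/

section Sandwich

variable {X : Type*} [m0 : MeasurableSpace X] {T : X → X} (hT : Measurable T)

/-- The join `⋁_{j < n} T^{-j}γⱼ`. -/
def seqJoin (γ : ℕ → CountablePartition X) (T : X → X) (hT : Measurable T) (n : ℕ) :
    CountablePartition X :=
  join fun j : Fin n => (γ j).preimage T^[j] (hT.iterate j)

theorem seqJoin_rel {γ : ℕ → CountablePartition X} {n : ℕ} {x y : X} :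
    (seqJoin γ T hT n).rel x y ↔ ∀ j < n, (γ j).rel (T^[j] x) (T^[j] y) :=
  ⟨fun h j hj => h ⟨j, hj⟩, fun h j => h j j.2⟩

theorem preimage_seqJoin_rel {γ : ℕ → CountablePartition X} {n : ℕ} {x y : X} :
    ((seqJoin γ T hT n).preimage T hT).rel x y ↔
      ∀ j < n, (γ j).rel (T^[j + 1] x) (T^[j + 1] y) := seqJoin_rel hT

theorem seqJoin_succ (γ : ℕ → CountablePartition X) (n : ℕ) :
    seqJoin γ T hT (n + 1) =
      (γ 0).inf ((seqJoin (fun j => γ (j + 1)) T hT n).preimage T hT) := by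
  refine ext_rel fun x y => ?_
  rw [seqJoin_rel, inf_rel, preimage_seqJoin_rel]
  constructor
  · exact fun h => ⟨h 0 n.succ_pos, fun j hj => h (j + 1) (by omega)⟩
  · rintro ⟨h0, h⟩ (_ | j) hj
    exacts [h0, h j (by omega)]

/-- Conditional probabilities of a coarser partition, evaluated at a time `j + 1 ≥ 1`, are thereby
measurable with respect to the past of the finer one. -/
theorem comap_iterate_sup_past_le {P P' : CountablePartition X}
    (h : ∀ x y, P.rel x y → P'.rel x y) (j : ℕ) :
    MeasurableSpace.comap T^[j + 1] (P'.sigmaAlgebra ⊔ P'.past T hT) ≤ P.past T hT := by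
  rw [MeasurableSpace.comap_sup, MeasurableSpace.comap_iSup]
  refine sup_le ?_ (iSup_le fun n => ?_)
  · refine (P'.comap_sigmaAlgebra_le (hT.iterate (j + 1))).trans (le_trans
      (sigmaAlgebra_mono fun x y hxy => ?_)
      (le_iSup (fun n : ℕ => (P.preimage T^[n + 1] (hT.iterate (n + 1))).sigmaAlgebra) j))
    exact h _ _ hxy
  · refine ((P'.preimage T^[n + 1] (hT.iterate (n + 1))).comap_sigmaAlgebra_le
      (hT.iterate (j + 1))).trans (le_trans (sigmaAlgebra_mono fun x y hxy => ?_)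
      (le_iSup (fun n : ℕ => (P.preimage T^[n + 1] (hT.iterate (n + 1))).sigmaAlgebra)
        (n + (j + 1))))
    have hxy' : P.rel (T^[n + (j + 1) + 1] x) (T^[n + (j + 1) + 1] y) := hxy
    rw [show n + (j + 1) + 1 = (n + 1) + (j + 1) by ring, Function.iterate_add_apply _ (n + 1),
      Function.iterate_add_apply _ (n + 1)] at hxy'
    exact h _ _ hxy'

theorem sigmaAlgebra_preimage_seqJoin_le_past {P : CountablePartition X}
    {γ : ℕ → CountablePartition X} (h : ∀ j x y, P.rel x y → (γ j).rel x y) (n : ℕ) :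
    ((seqJoin γ T hT n).preimage T hT).sigmaAlgebra ≤ P.past T hT := by
  rw [← P.iSup_pastFiltration hT]
  refine le_trans (sigmaAlgebra_mono fun x y hxy => ?_) (le_iSup (fun n => P.pastFiltration hT n) n)
  rw [preimage_iterJoin_rel] at hxy
  rw [preimage_seqJoin_rel]
  exact fun j hj => h j _ _ (hxy j hj)

variable {μ : Measure X}

theorem condProb_iterJoin_congr {P : CountablePartition X} {n : ℕ} {x y : X}
    (h : (P.iterJoin T hT (n + 1)).rel x y) :
    condProb (P.pastFiltration hT n) P μ x = condProb (P.pastFiltration hT n) P μ y := by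
  rw [iterJoin_succ, inf_rel] at h
  rw [condProb, condProb, P.cell_eq_of_rel h.1]
  exact eq_of_measurable_sigmaAlgebra _ stronglyMeasurable_condExp.measurable h.2

/-- Since `∑ (N + 1)⁻²` converges, `∑ W N / (N + 1)²` has finite integral; it is finite almost
everywhere and its terms tend to 0. -/
theorem eventually_le_sq_of_lintegral_le_one {W : ℕ → X → ENNReal} (hW : ∀ N, Measurable (W N))
    (h : ∀ N, ∫⁻ x, W N x ∂μ ≤ 1) : ∀ᵐ x ∂μ, ∀ᶠ N in atTop, W N x ≤ ENNReal.ofReal ((N + 1) ^ 2) := by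
  have hs : ∫⁻ x, ∑' N : ℕ, W N x * (ENNReal.ofReal ((N + 1) ^ 2))⁻¹ ∂μ ≠ ⊤ := by
    rw [lintegral_tsum fun N => ((hW N).mul_const _).aemeasurable]
    have hle : ∀ N : ℕ, ∫⁻ x, W N x * (ENNReal.ofReal ((N + 1) ^ 2))⁻¹ ∂μ ≤
        ENNReal.ofReal (((N + 1) ^ 2)⁻¹) := by
      intro N
      rw [lintegral_mul_const _ (hW N), ENNReal.ofReal_inv_of_pos (by positivity)]
      exact mul_le_of_le_one_left' (h N)
    refine ne_top_of_le_ne_top ?_ (ENNReal.tsum_le_tsum hle)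
    have := (summable_nat_add_iff 1).2 (Real.summable_nat_pow_inv.2 one_lt_two)
    refine Summable.tsum_ofReal_ne_top ?_
    simpa using this
  filter_upwards [ae_lt_top (Measurable.tsum fun N => (hW N).mul_const _) hs] with x hx
  have := ENNReal.tendsto_atTop_zero_of_tsum_ne_top hx.ne
  filter_upwards [this.eventually_le_const zero_lt_one] with N hN
  rw [← div_eq_mul_inv] at hN
  have h0 : ENNReal.ofReal (((N : ℝ) + 1) ^ 2) ≠ 0 := by
    rw [Ne, ENNReal.ofReal_eq_zero, not_le]
    positivity
  simpa using (ENNReal.div_le_iff h0 ENNReal.ofReal_ne_top).1 hN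

variable [IsProbabilityMeasure μ]

/-- Induction by peeling off time 0. On a fixed cell `A` of `γ 0` the whole integrand is measurable
with respect to the past of `γ 0`, because the later partitions are coarser. Replacing integration
over `A` by the weight `E[1_A|past]` cancels the time-0 factor. Summing `μ(A ∩ R(x))` over `A`
leaves `μ(R(x)) = μ(Q(T x))`, and invariance of `μ` reduces to the shifted sequence. -/
theorem lintegral_measure_cell_div_prod_condProb_le (hT : MeasurePreserving T μ μ) (n : ℕ)
    (γ : ℕ → CountablePartition X) (hγ : ∀ j x y, (γ j).rel x y → (γ (j + 1)).rel x y) :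
    ∫⁻ x, μ ((seqJoin γ T hT.measurable n).cell x) * ∏ j ∈ Finset.range n,
      (ENNReal.ofReal (condProb ((γ j).past T hT.measurable) (γ j) μ (T^[j] x)))⁻¹ ∂μ ≤ 1 := by
  induction n generalizing γ with
  | zero =>
    simp only [Finset.range_zero, Finset.prod_empty, mul_one]
    exact (lintegral_mono fun x => prob_le_one).trans (by simp)
  | succ n ih =>
    have hγ0 : ∀ j x y, (γ 0).rel x y → (γ j).rel x y := by
      intro j x y h
      induction j with
      | zero => exact h
      | succ j ihj => exact hγ j x y ihj
    set γ' : ℕ → CountablePartition X := fun j => γ (j + 1)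
    set Q := seqJoin γ' T hT.measurable n
    set K : X → ENNReal := fun y => ∏ j ∈ Finset.range n,
      (ENNReal.ofReal (condProb ((γ' j).past T hT.measurable) (γ' j) μ (T^[j] y)))⁻¹
    have hKm : Measurable K := Finset.measurable_prod _ fun j _ =>
      (((γ' j).measurable_condProb (sigmaAlgebra_le _) (past_le _ _)).comp
        (hT.measurable.iterate j)).ennreal_ofReal.inv
    have hKT : Measurable[(γ 0).past T hT.measurable] fun x => K (T x) := by
      refine Finset.measurable_prod _ fun j _ => ?_
      have h1 : Measurable[(γ' j).sigmaAlgebra ⊔ (γ' j).past T hT.measurable]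
          (condProb ((γ' j).past T hT.measurable) (γ' j) μ) :=
        (γ' j).measurable_condProb le_sup_left le_sup_right
      have h2 := h1.comp (measurable_iff_comap_le.2
        (comap_iterate_sup_past_le hT.measurable (hγ0 (j + 1)) j))
      exact h2.ennreal_ofReal.inv
    set R := Q.preimage T hT.measurable
    have hR : R.sigmaAlgebra ≤ (γ 0).past T hT.measurable :=
      sigmaAlgebra_preimage_seqJoin_le_past hT.measurable (fun j => hγ0 (j + 1)) n
    have h𝒜 := (γ 0).past_le hT.measurable
    have hG : ∀ A : Set X, Measurable[(γ 0).past T hT.measurable]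
        fun x => μ (A ∩ R.cell x) * K (T x) := fun A =>
      ((R.measurable_sigmaAlgebra_of_const
        (f := fun x => μ (A ∩ R.cell x)) fun x y h => by rw [R.cell_eq_of_rel h]).mono hR le_rfl).mul
        hKT
    calc _ = ∫⁻ x, μ ((γ 0).cell x ∩ R.cell x) * K (T x) *
          (ENNReal.ofReal (condProb ((γ 0).past T hT.measurable) (γ 0) μ x))⁻¹ ∂μ := by
          congr 1 with x
          rw [seqJoin_succ, inf_cell, Finset.prod_range_succ', mul_assoc]
          rfl
      _ = ∑' A : (γ 0).parts, ∫⁻ x in (A : Set X), μ (A ∩ R.cell x) * K (T x) *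
          (ENNReal.ofReal ((μ[(A : Set X).indicator (fun _ => (1 : ℝ)) |
            (γ 0).past T hT.measurable]) x))⁻¹ ∂μ := by
          rw [(γ 0).lintegral_eq_tsum_parts]
          congr 1 with A
          refine setLIntegral_congr_fun ((γ 0).measurableSet_of_mem_parts A.2) fun x hx => ?_
          simp only [condProb, (γ 0).cell_eq_of_mem A.2 hx]
      _ ≤ ∑' A : (γ 0).parts, ∫⁻ x, μ (A ∩ R.cell x) * K (T x) ∂μ := by
          refine ENNReal.tsum_le_tsum fun A => ?_
          rw [setLIntegral_eq_lintegral_mul_condExp h𝒜 ((γ 0).measurableSet_of_mem_parts A.2)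
            (g := fun x => μ (A ∩ R.cell x) * K (T x) * (ENNReal.ofReal ((μ[(A : Set X).indicator
              (fun _ => (1 : ℝ)) | (γ 0).past T hT.measurable]) x))⁻¹) ((hG A).mul (stronglyMeasurable_condExp.measurable.ennreal_ofReal.inv))]
          refine lintegral_mono fun x => ?_
          rw [mul_assoc]
          -- Only an inequality: the product is 0 where the conditional probability vanishes.
          exact mul_le_of_le_one_right' (ENNReal.inv_mul_le_one _)
      _ = ∫⁻ x, μ (Q.cell (T x)) * K (T x) ∂μ := by
          rw [← lintegral_tsum fun A : (γ 0).parts => ((hG A).mono h𝒜 le_rfl).aemeasurable]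
          congr 1 with x
          rw [ENNReal.tsum_mul_right, tsum_measure_inter_parts _ _ (R.measurableSet_cell x)]
          congr 1
          exact hT.measure_preimage (Q.measurableSet_cell (T x)).nullMeasurableSet
      _ = ∫⁻ y, μ (Q.cell y) * K y ∂μ := hT.lintegral_comp (Q.measurable_measure_cell.mul hKm)
      _ ≤ 1 := ih γ' fun j => hγ (j + 1)

/-- The product acts as a sub-probability on the cells of the join, provided each factor is constant
on them. The hypothesis on `e` secures this: factor `j` looks at `γ j` only at times `j, …, j + e
j`, all below `n` and all carrying partitions that refine `γ j`. In the inductive step one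
conditions on the later coordinates `R`: averaging `1_A / μ(A ∩ R(x))` gives at most `1 / μ(R(x))`,
and the time-0 probabilities sum to at most 1 over the cells `A`. -/
theorem lintegral_prod_condProb_div_measure_cell_le (hT : MeasurePreserving T μ μ) (n : ℕ)
    (γ : ℕ → CountablePartition X) (e : ℕ → ℕ)
    (he : ∀ j < n, j + e j < n ∧ ∀ i ≤ e j, ∀ x y, (γ (j + i)).rel x y → (γ j).rel x y) :
    ∫⁻ x, (μ ((seqJoin γ T hT.measurable n).cell x))⁻¹ * ∏ j ∈ Finset.range n,
      ENNReal.ofReal (condProb ((γ j).pastFiltration hT.measurable (e j)) (γ j) μ (T^[j] x)) ∂μ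
      ≤ 1 := by
  induction n generalizing γ e with
  | zero =>
    have : ∀ x, (seqJoin γ T hT.measurable 0).cell x = Set.univ := fun x =>
      Set.eq_univ_of_forall fun y => (seqJoin_rel hT.measurable).2 (by simp)
    simp [this]
  | succ n ih =>
    set γ' : ℕ → CountablePartition X := fun j => γ (j + 1)
    set e' : ℕ → ℕ := fun j => e (j + 1)
    have he' : ∀ j < n, j + e' j < n ∧ ∀ i ≤ e' j, ∀ x y, (γ' (j + i)).rel x y → (γ' j).rel x y := by
      intro j hj
      obtain ⟨h1, h2⟩ := he (j + 1) (by omega)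
      refine ⟨by simp only [e']; omega, fun i hi x y hxy => h2 i hi x y ?_⟩
      rwa [show j + 1 + i = j + i + 1 by ring]
    set Q := seqJoin γ' T hT.measurable n
    set ℱ := (γ 0).pastFiltration hT.measurable
    have h_le : ℱ (e 0) ≤ m0 := ℱ.le (e 0)
    set K : X → ENNReal := fun y => ∏ j ∈ Finset.range n, ENNReal.ofReal
      (condProb ((γ' j).pastFiltration hT.measurable (e' j)) (γ' j) μ (T^[j] y))
    have hKm : Measurable K := Finset.measurable_prod _ fun j _ =>
      (((γ' j).measurable_condProb (sigmaAlgebra_le _) (Filtration.le _ _)).comp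
        (hT.measurable.iterate j)).ennreal_ofReal
    have hKc : ∀ x y, Q.rel x y → K x = K y := by
      intro x y hxy
      refine Finset.prod_congr rfl fun j hj => ?_
      rw [Finset.mem_range] at hj
      rw [condProb_iterJoin_congr hT.measurable]
      rw [iterJoin_rel]
      intro i hi
      obtain ⟨h1, h2⟩ := he' j hj
      rw [← Function.iterate_add_apply, ← Function.iterate_add_apply, add_comm]
      refine h2 i (by omega) _ _ ?_
      exact (seqJoin_rel hT.measurable).1 hxy (j + i) (by omega)
    set R := Q.preimage T hT.measurable
    -- The finite past of `γ 0` of length `e 0` is already determined by `R`.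
    have h_const : ∀ f : X → ℝ, Measurable[ℱ (e 0)] f → ∀ x y, R.rel x y → f x = f y := by
      intro f hf x y hxy
      refine eq_of_measurable_sigmaAlgebra _ hf ?_
      rw [preimage_iterJoin_rel]
      rw [preimage_seqJoin_rel] at hxy
      obtain ⟨h1, h2⟩ := he 0 n.succ_pos
      intro j hj
      refine h2 (j + 1) (by omega) _ _ ?_
      rw [zero_add]
      exact hxy j (by omega)
    set E : Set X → X → ENNReal := fun A x =>
      ENNReal.ofReal ((μ[A.indicator (fun _ => (1 : ℝ)) | ℱ (e 0)]) x) with hE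
    have hEm : ∀ A, Measurable[ℱ (e 0)] (E A) := fun A =>
      stronglyMeasurable_condExp.measurable.ennreal_ofReal
    have hG : ∀ A : Set X, Measurable[R.sigmaAlgebra]
        fun x => (μ (A ∩ R.cell x))⁻¹ * (E A x * K (T x)) := fun A => by
      refine R.measurable_sigmaAlgebra_of_const fun x y hxy => ?_
      simp only [hE]
      rw [R.cell_eq_of_rel hxy, hKc _ _ hxy,
        h_const _ stronglyMeasurable_condExp.measurable x y hxy]
    have hF : Measurable fun x => (μ (Q.cell x))⁻¹ * K x := Q.measurable_measure_cell.inv.mul hKm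
    calc _ = ∫⁻ x, (μ ((γ 0).cell x ∩ R.cell x))⁻¹ *
          (ENNReal.ofReal (condProb (ℱ (e 0)) (γ 0) μ x) * K (T x)) ∂μ := by
          congr 1 with x
          rw [seqJoin_succ, inf_cell, Finset.prod_range_succ', mul_comm (∏ _ ∈ _, _)]
          rfl
      _ = ∑' A : (γ 0).parts, ∫⁻ x in (A : Set X),
          (μ (A ∩ R.cell x))⁻¹ * (E A x * K (T x)) ∂μ := by
          rw [(γ 0).lintegral_eq_tsum_parts]
          congr 1 with A
          refine setLIntegral_congr_fun ((γ 0).measurableSet_of_mem_parts A.2) fun x hx => ?_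
          simp only [condProb, (γ 0).cell_eq_of_mem A.2 hx, hE]
      _ ≤ ∑' A : (γ 0).parts, ∫⁻ x, (μ (R.cell x))⁻¹ * K (T x) * E A x ∂μ := by
          refine ENNReal.tsum_le_tsum fun A => ?_
          have hA := (γ 0).measurableSet_of_mem_parts A.2
          rw [setLIntegral_eq_lintegral_mul_condExp R.sigmaAlgebra_le hA (hG A)]
          refine lintegral_mono_ae ?_
          filter_upwards [R.condExp_indicator_sigmaAlgebra (μ := μ) hA,
            R.ae_measure_cell_ne_zero μ] with x hx hx0
          rw [hx, ENNReal.ofReal_div_of_pos (R.measureReal_cell_pos x hx0), ofReal_measureReal,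
            ofReal_measureReal, ENNReal.div_eq_inv_mul]
          calc _ = ((μ (A ∩ R.cell x))⁻¹ * μ (A ∩ R.cell x)) *
                ((μ (R.cell x))⁻¹ * K (T x) * E A x) := by ring
            _ ≤ _ := mul_le_of_le_one_left' (ENNReal.inv_mul_le_one _)
      _ ≤ ∫⁻ x, (μ (Q.cell (T x)))⁻¹ * K (T x) ∂μ := by
          rw [← lintegral_tsum (f := fun (A : (γ 0).parts) x => (μ (R.cell x))⁻¹ * K (T x) * E A x)
            fun A => ((R.measurable_measure_cell.inv.mul
            (hKm.comp hT.measurable)).mul ((hEm A).mono h_le le_rfl)).aemeasurable]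
          refine lintegral_mono_ae ?_
          filter_upwards [(γ 0).tsum_condExp_parts_le_one (μ := μ) h_le] with x hx
          rw [ENNReal.tsum_mul_left]
          have : μ (R.cell x) = μ (Q.cell (T x)) :=
            hT.measure_preimage (Q.measurableSet_cell (T x)).nullMeasurableSet
          rw [this]
          exact mul_le_of_le_one_right' hx
      _ = ∫⁻ y, (μ (Q.cell y))⁻¹ * K y ∂μ := hT.lintegral_comp hF
      _ ≤ 1 := ih γ' e' he'

/-- The logarithm of the first ratio estimate; the error term is `log ((N + 1)²)`. -/
theorem eventually_sum_condInfo_le_info (hT : MeasurePreserving T μ μ) (n : ℕ → ℕ)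
    (γ : ℕ → ℕ → CountablePartition X)
    (hγ : ∀ N j x y, (γ N j).rel x y → (γ N (j + 1)).rel x y) :
    ∀ᵐ x ∂μ, ∀ᶠ N : ℕ in atTop, ∑ j ∈ Finset.range (n N),
      condInfo ((γ N j).past T hT.measurable) (γ N j) μ (T^[j] x) ≤
      (seqJoin (γ N) T hT.measurable (n N)).info μ x + 2 * Real.log (N + 1) := by
  have hm : ∀ N, Measurable fun x => μ ((seqJoin (γ N) T hT.measurable (n N)).cell x) *
      ∏ j ∈ Finset.range (n N), (ENNReal.ofReal
        (condProb ((γ N j).past T hT.measurable) (γ N j) μ (T^[j] x)))⁻¹ := fun N =>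
    (measurable_measure_cell _).mul (Finset.measurable_prod _ fun j _ =>
      (((γ N j).measurable_condProb (sigmaAlgebra_le _) (past_le _ _)).comp
        (hT.measurable.iterate j)).ennreal_ofReal.inv)
  have hpos : ∀ᵐ x ∂μ, ∀ N j,
      0 < condProb ((γ N j).past T hT.measurable) (γ N j) μ (T^[j] x) :=
    ae_all_iff.2 fun N => ae_all_iff.2 fun j => (hT.iterate j).quasiMeasurePreserving.ae
      ((γ N j).condProb_pos (past_le _ _))
  filter_upwards [eventually_le_sq_of_lintegral_le_one hm
    (fun N => lintegral_measure_cell_div_prod_condProb_le hT (n N) (γ N) (hγ N)), hpos,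
    ae_all_iff.2 fun N => ae_measure_cell_ne_zero (seqJoin (γ N) T hT.measurable (n N)) μ]
    with x hx hx1 hx2
  filter_upwards [hx] with N hN
  have hQ := measureReal_cell_pos _ x (hx2 N)
  set r : ℕ → ℝ := fun j => condProb ((γ N j).past T hT.measurable) (γ N j) μ (T^[j] x)
  have hr : ∀ j, 0 < r j := hx1 N
  rw [← ofReal_measureReal (μ := μ), Finset.prod_congr rfl fun j _ =>
    (ENNReal.ofReal_inv_of_pos (hr j)).symm, ← ENNReal.ofReal_prod_of_nonneg
    fun j _ => (inv_pos.2 (hr j)).le, ← ENNReal.ofReal_mul hQ.le,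
    ENNReal.ofReal_le_ofReal_iff (by positivity)] at hN
  have hp : 0 < ∏ j ∈ Finset.range (n N), (r j)⁻¹ := Finset.prod_pos fun j _ => inv_pos.2 (hr j)
  have := Real.log_le_log (mul_pos hQ hp) hN
  rw [Real.log_mul hQ.ne' hp.ne', Real.log_prod fun j _ => (inv_pos.2 (hr j)).ne',
    Real.log_pow] at this
  simp only [Real.log_inv, Nat.cast_ofNat] at this
  simp only [condInfo_eq, info]
  linarith

theorem eventually_info_le_sum_condInfo (hT : MeasurePreserving T μ μ) (n : ℕ → ℕ)
    (γ : ℕ → ℕ → CountablePartition X) (e : ℕ → ℕ → ℕ)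
    (he : ∀ N, ∀ j < n N, j + e N j < n N ∧
      ∀ i ≤ e N j, ∀ x y, (γ N (j + i)).rel x y → (γ N j).rel x y) :
    ∀ᵐ x ∂μ, ∀ᶠ N : ℕ in atTop, (seqJoin (γ N) T hT.measurable (n N)).info μ x ≤
      ∑ j ∈ Finset.range (n N), condInfo ((γ N j).pastFiltration hT.measurable (e N j))
        (γ N j) μ (T^[j] x) + 2 * Real.log (N + 1) := by
  have hm : ∀ N, Measurable fun x => (μ ((seqJoin (γ N) T hT.measurable (n N)).cell x))⁻¹ *
      ∏ j ∈ Finset.range (n N), ENNReal.ofReal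
        (condProb ((γ N j).pastFiltration hT.measurable (e N j)) (γ N j) μ (T^[j] x)) := fun N =>
    (measurable_measure_cell _).inv.mul (Finset.measurable_prod _ fun j _ =>
      (((γ N j).measurable_condProb (sigmaAlgebra_le _) (Filtration.le _ _)).comp
        (hT.measurable.iterate j)).ennreal_ofReal)
  have hpos : ∀ᵐ x ∂μ, ∀ N j,
      0 < condProb ((γ N j).pastFiltration hT.measurable (e N j)) (γ N j) μ (T^[j] x) :=
    ae_all_iff.2 fun N => ae_all_iff.2 fun j => (hT.iterate j).quasiMeasurePreserving.ae
      ((γ N j).condProb_pos (Filtration.le _ _))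
  filter_upwards [eventually_le_sq_of_lintegral_le_one hm
    (fun N => lintegral_prod_condProb_div_measure_cell_le hT (n N) (γ N) (e N) (he N)), hpos,
    ae_all_iff.2 fun N => ae_measure_cell_ne_zero (seqJoin (γ N) T hT.measurable (n N)) μ]
    with x hx hx1 hx2
  filter_upwards [hx] with N hN
  have hQ := measureReal_cell_pos _ x (hx2 N)
  set r : ℕ → ℝ := fun j =>
    condProb ((γ N j).pastFiltration hT.measurable (e N j)) (γ N j) μ (T^[j] x)
  have hr : ∀ j, 0 < r j := hx1 N
  rw [← ofReal_measureReal (μ := μ), ← ENNReal.ofReal_inv_of_pos hQ,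
    ← ENNReal.ofReal_prod_of_nonneg fun j _ => (hr j).le,
    ← ENNReal.ofReal_mul (inv_pos.2 hQ).le, ENNReal.ofReal_le_ofReal_iff (by positivity)] at hN
  have hp : 0 < ∏ j ∈ Finset.range (n N), r j := Finset.prod_pos fun j _ => hr j
  have := Real.log_le_log (mul_pos (inv_pos.2 hQ) hp) hN
  rw [Real.log_mul (inv_pos.2 hQ).ne' hp.ne', Real.log_prod fun j _ => (hr j).ne',
    Real.log_pow, Real.log_inv] at this
  simp only [Nat.cast_ofNat] at this
  simp only [condInfo_eq, info, Finset.sum_neg_distrib]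
  linarith

end Sandwich

end CountablePartition

/-! ### Break times and averages over blocks of linearly growing length. -/

section BreakTimes

variable {k : ℕ} (a : Fin k → ℝ)

/-- The partial sum `a₁ + ⋯ + aᵢ`. -/
def weightSum (i : ℕ) : ℝ := ∑ j : Fin k with j.val < i, a j

/-- The time `⌈(a₁ + ⋯ + aᵢ) N⌉`. -/
noncomputable def breakTime (N i : ℕ) : ℕ := ⌈weightSum a i * N⌉₊

theorem weightSum_zero : weightSum a 0 = 0 := by simp [weightSum]

theorem weightSum_succ (i : Fin k) : weightSum a (i + 1) = weightSum a i + a i := by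
  have : ({j : Fin k | j.val < i.val + 1} : Finset (Fin k)) =
      insert i ({j : Fin k | j.val < i.val} : Finset (Fin k)) := by
    ext j
    simp only [Finset.mem_filter, Finset.mem_univ, true_and, Finset.mem_insert, Fin.ext_iff]
    omega
  rw [weightSum, this, Finset.sum_insert (by simp), add_comm, weightSum]

theorem weightSum_succ_eq_sum_Iic (i : Fin k) : weightSum a (i + 1) = ∑ j ∈ Finset.Iic i, a j := by
  rw [weightSum]
  congr 1
  ext j
  simp only [Finset.mem_filter, Finset.mem_univ, true_and, Finset.mem_Iic, Fin.le_def]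
  omega

theorem breakTime_zero (N : ℕ) : breakTime a N 0 = 0 := by simp [breakTime, weightSum_zero]

variable {a}

theorem weightSum_mono (ha : ∀ i, 0 ≤ a i) : Monotone (weightSum a) := fun _ _ h =>
  Finset.sum_le_sum_of_subset_of_nonneg
    (Finset.monotone_filter_right _ fun _ _ hj => lt_of_lt_of_le hj h) fun j _ _ => ha j

theorem weightSum_nonneg (ha : ∀ i, 0 ≤ a i) (i : ℕ) : 0 ≤ weightSum a i :=
  Finset.sum_nonneg fun j _ => ha j

theorem weightSum_succ_pos (hk : 0 < k) (ha₁ : 0 < a ⟨0, hk⟩) (ha : ∀ i, 0 ≤ a i) (i : ℕ) :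
    0 < weightSum a (i + 1) := by
  refine lt_of_lt_of_le ?_ (weightSum_mono ha (show 0 + 1 ≤ i + 1 by omega))
  have := weightSum_succ a ⟨0, hk⟩
  simp only [weightSum_zero] at this
  linarith

theorem breakTime_mono (ha : ∀ i, 0 ≤ a i) (N : ℕ) : Monotone (breakTime a N) := fun _ _ h =>
  Nat.ceil_mono (mul_le_mul_of_nonneg_right (weightSum_mono ha h) N.cast_nonneg)

theorem tendsto_breakTime_div (ha : ∀ i, 0 ≤ a i) (i : ℕ) :
    Tendsto (fun N : ℕ => (breakTime a N i : ℝ) / N) atTop (𝓝 (weightSum a i)) :=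
  (tendsto_nat_ceil_mul_div_atTop (weightSum_nonneg ha i)).comp tendsto_natCast_atTop_atTop

theorem tendsto_breakTime (hk : 0 < k) (ha₁ : 0 < a ⟨0, hk⟩) (ha : ∀ i, 0 ≤ a i) (i : ℕ) :
    Tendsto (fun N : ℕ => breakTime a N (i + 1)) atTop atTop :=
  tendsto_nat_ceil_atTop.comp
    (tendsto_natCast_atTop_atTop.const_mul_atTop (weightSum_succ_pos hk ha₁ ha i))

theorem sum_range_eq_sum_sum_Ico {c : ℕ → ℕ} (hc : Monotone c) (hc0 : c 0 = 0) (f : ℕ → ℝ)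
    (n : ℕ) : ∑ m ∈ Finset.range (c n), f m =
      ∑ i : Fin n, ∑ m ∈ Finset.Ico (c i) (c (i + 1)), f m := by
  rw [← Finset.sum_range fun i => ∑ m ∈ Finset.Ico (c i) (c (i + 1)), f m]
  induction n with
  | zero => simp [hc0]
  | succ n ih =>
    rw [Finset.sum_range_succ, ← ih, Finset.sum_Ico_eq_sub _ (hc n.le_succ)]
    ring

/-- The order of the Markov approximation at time `m`: `d`, or `0` near the end of a block. -/
noncomputable def markovOrder (a : Fin k → ℝ) (d N m : ℕ) : ℕ :=
  open Classical in
  if ∃ i : Fin k, breakTime a N i ≤ m ∧ m + d < breakTime a N (i + 1) then d else 0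

/-- The last time of the `i`-th block with Markov order `d`. -/
noncomputable def switchTime (a : Fin k → ℝ) (d i N : ℕ) : ℕ :=
  max (breakTime a N i) (breakTime a N (i + 1) - d)

/-- The order-`d` stretch excludes `switchTime` itself, and it is empty when the block has length at
most `d`. -/
theorem markovOrder_of_lt_switchTime {d N m : ℕ} {i : Fin k} (h : breakTime a N i ≤ m)
    (h' : m < switchTime a d i N) : markovOrder a d N m = d := by
  rw [markovOrder, if_pos]
  refine ⟨i, h, ?_⟩
  rw [switchTime, lt_max_iff] at h'
  omega

theorem markovOrder_of_switchTime_le (ha : ∀ i, 0 ≤ a i) {d N m : ℕ} {i : Fin k}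
    (h : switchTime a d i N ≤ m) (h' : m < breakTime a N (i + 1)) : markovOrder a d N m = 0 := by
  rw [markovOrder, if_neg]
  rintro ⟨j, h1, h2⟩
  rw [switchTime, max_le_iff] at h
  rcases lt_or_ge i.val j.val with hij | hij
  · have := breakTime_mono ha N (show i.val + 1 ≤ j from hij)
    omega
  · have := breakTime_mono ha N (show j.val + 1 ≤ i + 1 by omega)
    omega

theorem switchTime_le (ha : ∀ i, 0 ≤ a i) (d i N : ℕ) :
    switchTime a d i N ≤ breakTime a N (i + 1) :=
  max_le (breakTime_mono ha N i.le_succ) (Nat.sub_le _ _)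

theorem tendsto_switchTime_div (ha : ∀ i, 0 ≤ a i) (d i : ℕ) :
    Tendsto (fun N : ℕ => (switchTime a d i N : ℝ) / N) atTop (𝓝 (weightSum a (i + 1))) := by
  have h1 := (tendsto_breakTime_div ha (i + 1)).sub
    (tendsto_const_div_atTop_nhds_zero_nat (d : ℝ))
  rw [sub_zero] at h1
  refine tendsto_of_tendsto_of_tendsto_of_le_of_le h1 (tendsto_breakTime_div ha (i + 1))
    (fun N => ?_) (fun N => ?_)
  · rw [← sub_div]
    refine div_le_div_of_nonneg_right ?_ N.cast_nonneg
    rw [sub_le_iff_le_add]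
    have : breakTime a N (i + 1) ≤ switchTime a d i N + d :=
      Nat.sub_le_iff_le_add.1 (le_max_right _ _)
    rw [← Nat.cast_add]
    exact Nat.cast_le.2 this
  · exact div_le_div_of_nonneg_right (Nat.cast_le.2 (switchTime_le ha d i N)) N.cast_nonneg

theorem tendsto_switchTime (hk : 0 < k) (ha₁ : 0 < a ⟨0, hk⟩) (ha : ∀ i, 0 ≤ a i) (d i : ℕ) :
    Tendsto (switchTime a d i) atTop atTop :=
  tendsto_atTop_mono (fun _ => le_max_right _ _)
    ((tendsto_sub_atTop_nat d).comp (tendsto_breakTime hk ha₁ ha i))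

/-- Positivity of the first weight makes every break time but the zeroth diverge, even when later
blocks are empty. -/
theorem tendsto_breakTime_or (hk : 0 < k) (ha₁ : 0 < a ⟨0, hk⟩) (ha : ∀ i, 0 ≤ a i) (i : ℕ) :
    Tendsto (fun N => breakTime a N i) atTop atTop ∨ ∀ N, breakTime a N i = 0 := by
  rcases i with _ | i
  · exact Or.inr (breakTime_zero a)
  · exact Or.inl (tendsto_breakTime hk ha₁ ha i)

/-- In each block at most `d` times have their order lowered to 0. With `d` fixed, both ends of that
stretch have the same linear growth rate, so its contribution vanishes in the limit. -/
theorem tendsto_sum_markov_blocks (hk : 0 < k) (ha₁ : 0 < a ⟨0, hk⟩) (ha : ∀ i, 0 ≤ a i)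
    {f : Fin k → ℕ → ℕ → ℝ} {l : Fin k → ℕ → ℝ}
    (hf : ∀ i d, Tendsto (fun n : ℕ => (∑ m ∈ Finset.range n, f i d m) / n) atTop (𝓝 (l i d)))
    (d : ℕ) {s : ℕ → ℕ → ℝ}
    (hs : ∀ N, ∀ i : Fin k, ∀ m, breakTime a N i ≤ m → m < breakTime a N (i + 1) →
      s N m = f i (markovOrder a d N m) m) :
    Tendsto (fun N : ℕ => (∑ m ∈ Finset.range (breakTime a N k), s N m) / N) atTop
      (𝓝 (∑ i, a i * l i d)) := by
  have h : ∀ i : Fin k, Tendsto (fun N : ℕ => (∑ m ∈ Finset.Ico (breakTime a N i)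
      (switchTime a d i N), f i d m) / N + (∑ m ∈ Finset.Ico (switchTime a d i N)
      (breakTime a N (i + 1)), f i 0 m) / N) atTop (𝓝 (a i * l i d)) := by
    intro i
    have h1 := tendsto_sum_Ico_div (hf i d) (fun N => le_max_left (breakTime a N i) _)
      (tendsto_breakTime_div ha i) (tendsto_switchTime_div ha d i)
      (tendsto_breakTime_or hk ha₁ ha i) (tendsto_switchTime hk ha₁ ha d i)
    have h2 := tendsto_sum_Ico_div (hf i 0) (switchTime_le ha d i)
      (tendsto_switchTime_div ha d i) (tendsto_breakTime_div ha (i + 1))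
      (Or.inl (tendsto_switchTime hk ha₁ ha d i)) (tendsto_breakTime hk ha₁ ha i)
    have := h1.add h2
    rwa [sub_self, zero_mul, add_zero, weightSum_succ, add_sub_cancel_left] at this
  refine (tendsto_finsetSum _ fun i _ => h i).congr fun N => ?_
  rw [sum_range_eq_sum_sum_Ico (breakTime_mono ha N) (breakTime_zero a N), Finset.sum_div]
  refine Finset.sum_congr rfl fun i _ => ?_
  rw [← add_div, ← Finset.sum_Ico_consecutive (s N) (le_max_left _ _ : _ ≤ switchTime a d i N)
    (switchTime_le ha d i N)]
  congr 2
  · refine Finset.sum_congr rfl fun m hm => ?_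
    rw [Finset.mem_Ico] at hm
    rw [hs N i m hm.1 (hm.2.trans_le (switchTime_le ha d i N)),
      markovOrder_of_lt_switchTime hm.1 hm.2]
  · refine Finset.sum_congr rfl fun m hm => ?_
    rw [Finset.mem_Ico] at hm
    rw [hs N i m ((le_max_left _ _).trans hm.1) hm.2, markovOrder_of_switchTime_le ha hm.1 hm.2]

theorem tendsto_sum_blocks (hk : 0 < k) (ha₁ : 0 < a ⟨0, hk⟩) (ha : ∀ i, 0 ≤ a i)
    {f : Fin k → ℕ → ℝ} {l : Fin k → ℝ}
    (hf : ∀ i, Tendsto (fun n : ℕ => (∑ m ∈ Finset.range n, f i m) / n) atTop (𝓝 (l i)))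
    {s : ℕ → ℕ → ℝ} (hs : ∀ N, ∀ i : Fin k, ∀ m, breakTime a N i ≤ m → m < breakTime a N (i + 1) →
      s N m = f i m) :
    Tendsto (fun N : ℕ => (∑ m ∈ Finset.range (breakTime a N k), s N m) / N) atTop
      (𝓝 (∑ i, a i * l i)) :=
  tendsto_sum_markov_blocks hk ha₁ ha (f := fun i _ => f i) (fun i _ => hf i) 0 hs

end BreakTimes

namespace CountablePartition

/-! ### The partitions active at each time. -/

section Blocks

variable {X : Type*} [m0 : MeasurableSpace X] {k : ℕ} {a : Fin k → ℝ}
  {α : Fin k → CountablePartition X}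

/-- The partition `⋁_{j ≥ i} αⱼ`. -/
def tailJoin (α : Fin k → CountablePartition X) (i : Fin k) : CountablePartition X :=
  join fun j : {j : Fin k // i ≤ j} => α j

/-- The join of those `αⱼ` that are still active at time `m`. -/
noncomputable def activeJoin (α : Fin k → CountablePartition X) (a : Fin k → ℝ) (N m : ℕ) :
    CountablePartition X :=
  join fun j : {j : Fin k // m < breakTime a N (j + 1)} => α j

theorem activeJoin_rel {N m : ℕ} {x y : X} : (activeJoin α a N m).rel x y ↔
    ∀ j : Fin k, m < breakTime a N (j + 1) → (α j).rel x y :=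
  ⟨fun h j hj => h ⟨j, hj⟩, fun h j => h j j.2⟩

theorem activeJoin_rel_succ {N m : ℕ} {x y : X} (h : (activeJoin α a N m).rel x y) :
    (activeJoin α a N (m + 1)).rel x y := by
  rw [activeJoin_rel] at h ⊢
  exact fun j hj => h j (by omega)

theorem activeJoin_eq_tailJoin (ha : ∀ i, 0 ≤ a i) {N m : ℕ} {i : Fin k}
    (h : breakTime a N i ≤ m) (h' : m < breakTime a N (i + 1)) :
    activeJoin α a N m = tailJoin α i := by
  refine ext_rel fun x y => ?_
  rw [activeJoin_rel]
  refine Iff.trans ?_ (show (∀ j : Fin k, i ≤ j → (α j).rel x y) ↔ _ from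
    ⟨fun h j => h j j.2, fun h j hj => h ⟨j, hj⟩⟩)
  refine forall_congr' fun j => imp_congr_left ⟨fun hj => ?_, fun hj => ?_⟩
  · by_contra hlt
    rw [not_le, Fin.lt_def] at hlt
    have := breakTime_mono ha N (show j.val + 1 ≤ i from hlt)
    omega
  · rw [Fin.le_def] at hj
    exact h'.trans_le (breakTime_mono ha N (by omega))

/-- Exchange of quantifiers: both sides test `α j` at exactly the times before its own break time.
-/
theorem seqJoin_activeJoin {T : X → X} (hT : Measurable T) (ha : ∀ i, 0 ≤ a i) (N : ℕ) :
    (join fun i : Fin k =>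
      (α i).iterJoin T hT ⌈(∑ j ∈ Finset.Iic i, a j) * (N : ℝ)⌉₊) =
      seqJoin (activeJoin α a N) T hT (breakTime a N k) := by
  refine ext_rel fun x y => ?_
  rw [seqJoin_rel]
  have hc : ∀ i : Fin k, ⌈(∑ j ∈ Finset.Iic i, a j) * (N : ℝ)⌉₊ = breakTime a N (i + 1) :=
    fun i => by rw [breakTime, weightSum_succ_eq_sum_Iic]
  constructor
  · intro h m _
    rw [activeJoin_rel]
    intro j hj
    exact (iterJoin_rel hT (α j)).1 (h j) m (by rwa [hc])
  · intro h i
    rw [iterJoin_rel, hc]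
    intro m hm
    exact activeJoin_rel.1 (h m (hm.trans_le (breakTime_mono ha N (by omega)))) i hm

/-- A window of positive order stays inside one block, where the active partition does not change.
Dropping to order 0 near the end of a block is what makes the upper ratio estimate applicable. -/
theorem markovOrder_spec (ha : ∀ i, 0 ≤ a i) (d N m : ℕ) (hm : m < breakTime a N k) :
    m + markovOrder a d N m < breakTime a N k ∧ ∀ i ≤ markovOrder a d N m, ∀ x y,
      (activeJoin α a N (m + i)).rel x y → (activeJoin α a N m).rel x y := by
  rw [markovOrder]
  split_ifs with h
  · obtain ⟨i, h1, h2⟩ := h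
    refine ⟨h2.trans_le (breakTime_mono ha N (by omega)), fun j hj x y hxy => ?_⟩
    rw [activeJoin_eq_tailJoin ha (i := i) (by omega) (by omega)] at hxy ⊢
    exact hxy
  · refine ⟨hm, fun j hj x y hxy => ?_⟩
    rwa [Nat.le_zero.1 hj] at hxy

end Blocks

/-! ### Closing the sandwich. -/

section Main

variable {X : Type*} {m : MeasurableSpace X} [m0 : MeasurableSpace X] {μ : Measure X}
  {T : X → X} {k : ℕ} {a : Fin k → ℝ} {α : Fin k → CountablePartition X}

theorem tendsto_log_succ_div : Tendsto (fun N : ℕ => 2 * Real.log (N + 1) / N) atTop (𝓝 0) := by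
  have h1 : Tendsto (fun N : ℕ => Real.log ((N : ℝ) + 1) / ((N : ℝ) + 1)) atTop (𝓝 0) := by
    have := (Real.isLittleO_log_id_atTop.tendsto_div_nhds_zero).comp
      (tendsto_atTop_add_const_right atTop (1 : ℝ) tendsto_natCast_atTop_atTop)
    exact this
  have h2 : Tendsto (fun N : ℕ => 2 * (1 + 1 / (N : ℝ))) atTop (𝓝 (2 * (1 + 0))) :=
    (tendsto_const_nhds.add tendsto_one_div_atTop_nhds_zero_nat).const_mul _
  have h3 := h1.mul h2
  rw [zero_mul] at h3
  refine h3.congr' ?_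
  filter_upwards [eventually_gt_atTop 0] with N hN
  have : (N : ℝ) ≠ 0 := by exact_mod_cast hN.ne'
  have : (N : ℝ) + 1 ≠ 0 := by positivity
  field_simp

/-- If `f d → l` in mean and `l ≤ f d`, then `l` is the infimum of the `f d`. -/
theorem ae_exists_lt_of_tendsto_integral {f : ℕ → X → ℝ} {l : X → ℝ}
    (hf : ∀ d, Integrable (f d) μ) (hl : Integrable l μ) (hle : ∀ d, l ≤ᵐ[μ] f d)
    (hlim : Tendsto (fun d => ∫ x, f d x ∂μ) atTop (𝓝 (∫ x, l x ∂μ))) :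
    ∀ᵐ x ∂μ, ∀ b, l x < b → ∃ d, f d x < b := by
  have hm : ∀ d, AEMeasurable (fun x => ENNReal.ofReal (f d x - l x)) μ := fun d =>
    ((hf d).sub hl).aestronglyMeasurable.aemeasurable.ennreal_ofReal
  -- The infimum lies below every nonnegative `f d - l`, whose integrals tend to 0; no monotonicity
  -- in `d` is needed.
  have h0 : ∫⁻ x, ⨅ d, ENNReal.ofReal (f d x - l x) ∂μ = 0 := by
    have h1 := (ENNReal.continuous_ofReal.tendsto _).comp (hlim.sub_const (∫ x, l x ∂μ))
    rw [sub_self, ENNReal.ofReal_zero] at h1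
    refine le_antisymm (ge_of_tendsto' h1 fun d => ?_) zero_le
    rw [Function.comp_apply, ← integral_sub (hf d) hl, ofReal_integral_eq_lintegral_ofReal
      (f := fun x => f d x - l x) ((hf d).sub hl) ((hle d).mono fun x hx => sub_nonneg.2 hx)]
    exact lintegral_mono fun x => iInf_le _ d
  rw [lintegral_eq_zero_iff' (AEMeasurable.iInf hm)] at h0
  filter_upwards [h0] with x hx b hb
  have h1 : ⨅ d, ENNReal.ofReal (f d x - l x) < ENNReal.ofReal (b - l x) := by
    rw [hx]
    simpa using hb
  obtain ⟨d, hd⟩ := iInf_lt_iff.1 h1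
  refine ⟨d, ?_⟩
  have := (ENNReal.ofReal_lt_ofReal_iff (sub_pos.2 hb)).1 hd
  linarith

variable [IsProbabilityMeasure μ]

theorem tendsto_sum_iterate_div (hT : MeasurePreserving T μ μ) {f : X → ℝ}
    (hf : Integrable f μ) : ∀ᵐ x ∂μ, Tendsto
      (fun n : ℕ => (∑ m ∈ Finset.range n, f (T^[m] x)) / n) atTop
      (𝓝 ((μ[f | almostInvariants μ T]) x)) := tendsto_birkhoffSum_div hT hf

theorem integral_sum_condExp {f : Fin k → X → ℝ} (hm : m ≤ m0) :
    ∫ x, ∑ i, a i * (μ[f i | m]) x ∂μ = ∑ i, a i * ∫ x, f i x ∂μ := by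
  rw [integral_finsetSum _ fun i _ => integrable_condExp.const_mul (a i)]
  refine Finset.sum_congr rfl fun i _ => ?_
  rw [integral_const_mul, integral_condExp hm]

/-- The lower limit is at least `L` and the upper limit at most every `U d`; the integrals of the `U
d` converge to that of `L`, so the bounds meet almost everywhere. -/
theorem tendsto_info_seqJoin_div (hT : MeasurePreserving T μ μ) (hk : 0 < k)
    (ha₁ : 0 < a ⟨0, hk⟩) (ha : ∀ i, 0 ≤ a i) (hα : ∀ i, (α i).entropy μ < ⊤) :
    ∀ᵐ x ∂μ, Tendsto (fun N : ℕ =>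
      (seqJoin (activeJoin α a N) T hT.measurable (breakTime a N k)).info μ x / N) atTop
      (𝓝 (∑ i, a i * (μ[condInfo ((tailJoin α i).past T hT.measurable) (tailJoin α i) μ |
        almostInvariants μ T]) x)) := by
  have hβ : ∀ i, (tailJoin α i).entropy μ < ⊤ := fun i => entropy_join_lt_top α _ hα
  set F : Fin k → X → ℝ := fun i =>
    condInfo ((tailJoin α i).past T hT.measurable) (tailJoin α i) μ with hF
  set G : Fin k → ℕ → X → ℝ := fun i d =>
    condInfo ((tailJoin α i).pastFiltration hT.measurable d) (tailJoin α i) μ with hG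
  have hFi : ∀ i, Integrable (F i) μ := fun i =>
    integrable_condInfo _ (past_le _ _) (hβ i).ne
  have hGi : ∀ i d, Integrable (G i d) μ := fun i d =>
    integrable_condInfo _ (Filtration.le _ _) (hβ i).ne
  set L : X → ℝ := fun x => ∑ i, a i * (μ[F i | almostInvariants μ T]) x with hL
  set U : ℕ → X → ℝ := fun d x => ∑ i, a i * (μ[G i d | almostInvariants μ T]) x with hU
  have hLi : Integrable L μ := integrable_finsetSum _ fun i _ => integrable_condExp.const_mul (a i)
  have hUi : ∀ d, Integrable (U d) μ := fun d =>
    integrable_finsetSum _ fun i _ => integrable_condExp.const_mul (a i)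
  have hlow : ∀ᵐ x ∂μ, ∃ S : ℕ → ℝ, Tendsto (fun N : ℕ => S N / N) atTop (𝓝 (L x)) ∧
      ∀ᶠ N : ℕ in atTop, S N ≤ (seqJoin (activeJoin α a N) T hT.measurable
        (breakTime a N k)).info μ x + 2 * Real.log (N + 1) := by
    filter_upwards [eventually_sum_condInfo_le_info hT (fun N => breakTime a N k)
      (fun N => activeJoin α a N) fun N j x y h => activeJoin_rel_succ h,
      ae_all_iff.2 fun i => tendsto_sum_iterate_div hT (hFi i)] with x h1 h2
    refine ⟨_, tendsto_sum_blocks hk ha₁ ha h2 fun N i m h h' => ?_, h1⟩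
    rw [activeJoin_eq_tailJoin ha h h']
  have hupp : ∀ᵐ x ∂μ, ∀ d, ∃ S : ℕ → ℝ, Tendsto (fun N : ℕ => S N / N) atTop (𝓝 (U d x)) ∧
      ∀ᶠ N : ℕ in atTop, (seqJoin (activeJoin α a N) T hT.measurable
        (breakTime a N k)).info μ x ≤ S N + 2 * Real.log (N + 1) := by
    filter_upwards [ae_all_iff.2 fun d => eventually_info_le_sum_condInfo hT
      (fun N => breakTime a N k) (fun N => activeJoin α a N) (markovOrder a d)
      fun N j hj => markovOrder_spec ha d N j hj,
      ae_all_iff.2 fun i => ae_all_iff.2 fun d => tendsto_sum_iterate_div hT (hGi i d)]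
      with x h1 h2 d
    refine ⟨_, tendsto_sum_markov_blocks hk ha₁ ha h2 d fun N i m h h' => ?_, h1 d⟩
    rw [activeJoin_eq_tailJoin ha h h']
  have hlog := tendsto_log_succ_div
  -- The two bounds surround the same information function, so the comparison of their limits needs
  -- no separate inequality between conditional expectations.
  have hle : ∀ d, L ≤ᵐ[μ] U d := by
    intro d
    filter_upwards [hlow, hupp] with x h1 h2
    obtain ⟨S, hS, hS'⟩ := h1
    obtain ⟨R, hR, hR'⟩ := h2 d
    have := (hR.add hlog).add hlog
    rw [add_zero, add_zero] at this
    refine le_of_tendsto_of_tendsto hS this ?_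
    filter_upwards [hS', hR'] with N h1 h2
    rw [← add_div, ← add_div]
    exact div_le_div_of_nonneg_right (by linarith) N.cast_nonneg
  have hlim : Tendsto (fun d => ∫ x, U d x ∂μ) atTop (𝓝 (∫ x, L x ∂μ)) := by
    simp only [hU, hL, integral_sum_condExp (almostInvariants_le μ T)]
    refine tendsto_finsetSum _ fun i _ => Tendsto.const_mul (a i) ?_
    simp only [hG, hF, integral_condInfo _ (past_le _ _), integral_condInfo _ (Filtration.le _ _)]
    exact tendsto_condEntropy_pastFiltration _ _ (hβ i)
  filter_upwards [hlow, hupp, ae_exists_lt_of_tendsto_integral hUi hLi hle hlim] with x h1 h2 h3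
  rw [tendsto_order]
  refine ⟨fun b hb => ?_, fun b hb => ?_⟩
  · obtain ⟨S, hS, hS'⟩ := h1
    have := hS.sub hlog
    rw [sub_zero] at this
    filter_upwards [this.eventually_const_lt hb, hS'] with N h1 h2
    refine h1.trans_le ?_
    rw [← sub_div]
    exact div_le_div_of_nonneg_right (by linarith) N.cast_nonneg
  · obtain ⟨d, hd⟩ := h3 b hb
    obtain ⟨S, hS, hS'⟩ := h2 d
    have := hS.add hlog
    rw [add_zero] at this
    filter_upwards [this.eventually_lt_const hd, hS'] with N h1 h2
    refine lt_of_le_of_lt ?_ h1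
    rw [← add_div]
    exact div_le_div_of_nonneg_right h2 N.cast_nonneg

end Main

end CountablePartition

/-- The conditional expectation is almost invariant, hence almost everywhere constant; integrating
determines the constant. -/
theorem Ergodic.condExp_almostInvariants {X : Type*} [MeasurableSpace X] {μ : Measure X}
    [IsProbabilityMeasure μ] {T : X → X} (hT : Ergodic T μ) (f : X → ℝ) :
    ∀ᵐ x ∂μ, (μ[f | almostInvariants μ T]) x = ∫ y, f y ∂μ := by
  have hm := almostInvariants_le μ T
  have hh : StronglyMeasurable[almostInvariants μ T] (μ[f | almostInvariants μ T]) :=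
    stronglyMeasurable_condExp
  obtain ⟨c, hc⟩ := hT.ae_eq_const_of_ae_eq_comp_ae
    (hh.mono hm).aestronglyMeasurable hh.measurable.comp_ae_eq_of_almostInvariants
  have := integral_condExp (μ := μ) (f := f) hm
  rw [integral_congr_ae hc] at this
  filter_upwards [hc] with x hx
  rw [hx, ← this]
  simp

theorem propositionA2 {X : Type*} [MeasurableSpace X] (μ : Measure X) [IsProbabilityMeasure μ]
    (T : X → X) (hT : MeasurePreserving T μ μ) (k : ℕ) (hk : 0 < k)
    (α : Fin k → CountablePartition X) (hα : ∀ i, (α i).entropy μ < ⊤)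
    (a : Fin k → ℝ) (ha₁ : 0 < a ⟨0, hk⟩) (ha : ∀ i, 0 ≤ a i)
    (β : Fin k → CountablePartition X)
    (hβ : β = fun i => CountablePartition.join fun j : {j : Fin k // i ≤ j} => α j)
    (F : Fin k → X → ℝ)
    (hF : F = fun i => CountablePartition.condInfo ((β i).past T hT.measurable) (β i) μ)
    (I : ℕ → X → ℝ)
    (hI : I = fun N : ℕ => (CountablePartition.join fun i : Fin k =>
      (α i).iterJoin T hT.measurable ⌈(∑ j ∈ Finset.Iic i, a j) * (N : ℝ)⌉₊).info μ) :
    (∀ i, Integrable (F i) μ) ∧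
    (∀ᵐ x ∂μ, Tendsto (fun N : ℕ => 1 / (N : ℝ) * I N x) atTop
      (𝓝 (∑ i, a i * (μ[F i | almostInvariants μ T]) x))) ∧
    (Ergodic T μ →
      (∀ i, Tendsto (fun n : ℕ => (((β i).iterJoin T hT.measurable n).entropy μ).toReal / n)
        atTop (𝓝 ((β i).dynEntropy μ T hT.measurable))) ∧
      ∀ᵐ x ∂μ, Tendsto (fun N : ℕ => 1 / (N : ℝ) * I N x) atTop
        (𝓝 (∑ i, a i * (β i).dynEntropy μ T hT.measurable))) := by

  have hβ' : ∀ i, β i = CountablePartition.tailJoin α i := fun i => by rw [hβ]; rfl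
  have hβe : ∀ i, (β i).entropy μ < ⊤ := fun i => by
    rw [hβ']
    exact CountablePartition.entropy_join_lt_top α _ hα
  have hlim : ∀ᵐ x ∂μ, Tendsto (fun N : ℕ => 1 / (N : ℝ) * I N x) atTop
      (𝓝 (∑ i, a i * (μ[F i | almostInvariants μ T]) x)) := by
    filter_upwards [CountablePartition.tendsto_info_seqJoin_div hT hk ha₁ ha hα] with x hx
    simp only [hI, hF, hβ', CountablePartition.seqJoin_activeJoin hT.measurable ha,
      one_div_mul_eq_div]
    exact hx
  refine ⟨fun i => ?_, hlim, fun hE => ⟨fun i => ?_, ?_⟩⟩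
  · rw [hF]
    exact CountablePartition.integrable_condInfo _ (CountablePartition.past_le _ _) (hβe i).ne
  · rw [CountablePartition.dynEntropy_eq _ hT (hβe i)]
    exact CountablePartition.tendsto_entropy_iterJoin_div _ hT (hβe i)
  · filter_upwards [hlim, ae_all_iff.2 fun i => hE.condExp_almostInvariants (F i)] with x hx hx'
    -- Both `∫ F i` and the dynamical entropy equal the conditional entropy of `β i` given its past.
    have h : ∀ i, a i * (β i).dynEntropy μ T hT.measurable =
        a i * (μ[F i | almostInvariants μ T]) x := fun i => by
      rw [hx' i, CountablePartition.dynEntropy_eq _ hT (hβe i), hF,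
        CountablePartition.integral_condInfo _ (CountablePartition.past_le _ _)]
    simpa only [h] using hx
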